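/- Let $A$ be a finite-dimensional commutative associative algebra with unit over $\mathbb{C}$ with its usual (Hausdorff vector space) topology, let $\mathcal{I}_1,\dots,\mathcal{I}_m$ be its maximal ideals, and let $f_u:A\to\mathbb{C}$ be the multiplicative linear functional with kernel $\mathcal{I}_u$ ($f_u(1)=1$); these are all the unital algebra homomorphisms $A\to\mathbb{C}$. Let $e_1=1,e_2,\dots,e_k\in A$, $k\ge 2$, be linearly independent over $\mathbb{R}$, let $E_k=\{\sum_{j=1}^k x_je_j: x_j\in\mathbb{R}\}$, identified with the Euclidean space $\mathbb{R}^k$ through the coordinates $x_j$ (topology, rectifiability and circles in $E_k$ are those of $\mathbb{R}^k$), and let $M_u=\{\zeta\in E_k: f_u(\zeta)=0\}$. Assume that $f_u(E_k)=\mathbb{C}$ for all $u=1,\dots,m$. Let $\Omega\subset E_k$ be a domain that is convex with respect to the sets of directions $M_u$: for every $u$, $\Omega$ contains the segment between $\zeta_1$ and $\zeta_2$ whenever $\zeta_1,\zeta_2\in\Omega$ and $\zeta_2-\zeta_1\in M_u$. Let $\Phi:\Omega\to A$ be monogenic, i.e. continuous and such that for each $\zeta\in\Omega$ there is $\Phi'(\zeta)\in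 A$ with $\lim_{\varepsilon\to0+}(\Phi(\zeta+\varepsilon h)-\Phi(\zeta))\varepsilon^{-1}=h\,\Phi'(\zeta)$ for all $h\in E_k$. Let $\zeta_0\in\Omega$, let $S=\{\zeta\in E_k:\zeta-\zeta_0\in\bigcup_{u=1}^m M_u\}$, and let $\gamma$ be a closed rectifiable Jordan curve in $\Omega$ that embraces $S$ once. This means that in some two-dimensional plane through $\zeta_0$ there is a (once traversed) circle $C(\zeta_0,\varepsilon)$ with centre $\zeta_0$ and radius $\varepsilon>0$ such that (i) $C(\zeta_0,\varepsilon)$ is contained in $\Omega$ together with the closed disc that it bounds in its plane; (ii) for each $u$ the image of $C(\zeta_0,\varepsilon)$ under $f_u$ is the boundary of a bounded domain of $\mathbb{C}$ that contains $f_u(\zeta_0)$; (iii) $\gamma$ is homotopic to $C(\zeta_0,\varepsilon)$, through closed curves, in $\Omega\setminus S$. Then, for every such circle, with $C(0,\varepsilon)=C(\zeta_0,\varepsilon)-\zeta_0$ its translate (with the same orientation) and with $\int_\gamma\Psi(\zeta)\,d\zeta$ the limit of the Riemann–Stieltjes sums $\sum_i\Psi(\zeta(\tau_i))(\zeta(t_{i+1})-\zeta(t_i))$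 as the mesh of the partition tends to zero, the integrals below exist and $$\lambda\,\Phi(\zeta_0)=\int_\gamma\Phi(\zeta)(\zeta-\zeta_0)^{-1}\,d\zeta,\qquad \lambda:=\int_{C(0,\varepsilon)}\zeta^{-1}\,d\zeta .$$ -/

import Mathlib

open Set Filter Topology

namespace CauchyFormula

/-- `ℝ^k` with its Euclidean norm; it carries the topology and the metric of `E_k`. -/
abbrev Coord (k : ℕ) : Type := EuclideanSpace ℝ (Fin k)

section Algebra

variable {A : Type*} [CommRing A] [Algebra ℂ A] {k : ℕ}

/-- The element `ζ = ∑ x_j e_j` of `E_k` with real coordinates `x`.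
Subsets of, curves in and functions on `E_k` are given in these coordinates. -/
def point (e : Fin k → A) (x : Coord k) : A := ∑ j, x j • e j

/-- The points `ζ` of `E_k` with `ζ - ζ₀ ∈ ⋃ M_u`, where `M_u = {ζ ∈ E_k : f_u(ζ) = 0}` and
`f_u` runs over the multiplicative linear functionals `A → ℂ` (one for each maximal ideal). -/
def singularSet (e : Fin k → A) (x₀ : Coord k) : Set (Coord k) :=
  {x | ∃ f : A →ₐ[ℂ] ℂ, f (point e x - point e x₀) = 0}

/-- `Ω` is convex with respect to the sets of directions `M_u`, for all `u`. -/
def ConvexAlongDirections (e : Fin k → A) (Ω : Set (Coord k)) : Prop :=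
  ∀ f : A →ₐ[ℂ] ℂ, ∀ x ∈ Ω, ∀ y ∈ Ω, f (point e y - point e x) = 0 → segment ℝ x y ⊆ Ω

/-- Monogenic function in `Ω`: continuous, with a Gateaux derivative `d = Φ'(ζ) ∈ A` at each
point. -/
def Monogenic [TopologicalSpace A] (e : Fin k → A) (Ω : Set (Coord k)) (Φ : Coord k → A) :
    Prop :=
  ContinuousOn Φ Ω ∧ ∀ x ∈ Ω, ∃ d : A, ∀ h : Coord k,
    Tendsto (fun ε : ℝ => ε⁻¹ • (Φ (x + ε • h) - Φ x)) (𝓝[>] 0) (𝓝 (point e h * d))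

/-- `∫_γ Ψ(ζ) dζ` exists and equals `I`, for a curve `γ` parametrized by `[0, 1]`: the
Riemann–Stieltjes sums `∑ Ψ(ζ(τ_i)) (ζ(t_{i+1}) - ζ(t_i))`, where `ζ(t) = ∑ γ_j(t) e_j`,
converge to `I` as the mesh of the tagged partition tends to zero. -/
def HasCurveIntegral [TopologicalSpace A] (e : Fin k → A) (γ : ℝ → Coord k)
    (Ψ : Coord k → A) (I : A) : Prop :=
  ∀ U ∈ 𝓝 I, ∃ δ > (0 : ℝ), ∀ (N : ℕ) (t τ : ℕ → ℝ), t 0 = 0 → t N = 1 →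
    (∀ i < N, t i ≤ τ i ∧ τ i ≤ t (i + 1) ∧ t (i + 1) - t i < δ) →
    ∑ i ∈ Finset.range N, Ψ (γ (τ i)) * (point e (γ (t (i + 1))) - point e (γ (t i))) ∈ U

end Algebra

section Curves

variable {k : ℕ}

/-- Closed rectifiable Jordan curve, parametrized by `[0, 1]`. -/
structure IsClosedRectifiableJordan (γ : ℝ → Coord k) : Prop where
  continuousOn : ContinuousOn γ (Icc 0 1)
  closed : γ 0 = γ 1
  injOn : InjOn γ (Ico 0 1)
  rectifiable : BoundedVariationOn γ (Icc 0 1)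

/-- The closed curves `γ₀`, `γ₁`, parametrized by `[0, 1]`, are homotopic in `U` through
closed curves. -/
def ClosedHomotopicIn (U : Set (Coord k)) (γ₀ γ₁ : ℝ → Coord k) : Prop :=
  ∃ H : ℝ × ℝ → Coord k,
    ContinuousOn H (Icc 0 1 ×ˢ Icc 0 1) ∧ MapsTo H (Icc 0 1 ×ˢ Icc 0 1) U ∧
    (∀ t ∈ Icc (0 : ℝ) 1, H (0, t) = γ₀ t) ∧ (∀ t ∈ Icc (0 : ℝ) 1, H (1, t) = γ₁ t) ∧
    ∀ s ∈ Icc (0 : ℝ) 1, H (s, 0) = H (s, 1)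

/-- The circle with centre `x₀` and radius `ε` in the plane `x₀ + span {a, b}`, for an
orthonormal pair `a, b`, run through once by `t ∈ [0, 1]`. -/
noncomputable def circle (x₀ a b : Coord k) (ε : ℝ) (t : ℝ) : Coord k :=
  x₀ + ε • (Real.cos (2 * Real.pi * t) • a + Real.sin (2 * Real.pi * t) • b)

end Curves

/-- The circle `C(ζ₀, ε)` in the plane `ζ₀ + span {a, b}`, which lies in `Ω` together with the
disc that it bounds, embraces `{ζ : ζ - ζ₀ ∈ ⋃ M_u}`: for each `u` its image under `f_u` bounds
a domain `D` of the complex plane with `f_u(ζ₀) ∈ D`. -/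
structure IsEmbracingCircle {A : Type*} [CommRing A] [Algebra ℂ A] {k : ℕ} (e : Fin k → A)
    (Ω : Set (Coord k)) (x₀ a b : Coord k) (ε : ℝ) : Prop where
  radius_pos : 0 < ε
  orthonormal : Orthonormal ℝ ![a, b]
  disc_subset : {x | x - x₀ ∈ Submodule.span ℝ {a, b} ∧ ‖x - x₀‖ ≤ ε} ⊆ Ω
  embraces : ∀ f : A →ₐ[ℂ] ℂ, ∃ D : Set ℂ, IsOpen D ∧ IsConnected D ∧ Bornology.IsBounded D ∧
    frontier D = (fun t => f (point e (circle x₀ a b ε t))) '' Icc 0 1 ∧ f (point e x₀) ∈ D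

end CauchyFormula

/-! The form `Φ dζ` is closed, and so is `Φ(ζ)(ζ - ζ₀)⁻¹ dζ` wherever `ζ - ζ₀` is invertible. An
element on which no character vanishes is invertible, so this region contains `Ω \ S`. Homotopy
invariance moves the integral from `γ` to the given circle, and then to concentric circles of radius
`r ≤ ε`. Dilation about `ζ₀` does not change `(ζ - ζ₀)⁻¹ dζ`, so as `r → 0` continuity of `Φ` leaves
`λ Φ(ζ₀)`.

Closedness is the hard point: the Gateaux derivative is only known to exist pointwise, so neither
Stokes' theorem nor the uniform linear approximation behind Goursat's bisection is at hand. Pulled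
back to a square that parametrizes a triangle, the form has continuous coefficients with `∂P/∂y =
∂Q/∂x` at each interior point, and the Looman–Menchoff theorem (`subset_closedAt`) applies. Its
proof uses Baire's theorem to find a portion of the bad set from which `P` and `Q` are uniformly
Lipschitz along the axes. Near it, the boundary integral of a rectangle is bounded by the measure of
the good points in it (`abs_rectIntegral_le`), and subdivision makes this bound arbitrarily small.
From triangles (`segIntegral_add`) one gets primitives along continuous maps (`exists_primitive`),
and hence homotopy invariance.

The circles can be shrunk because no character kills a direction of their plane: otherwise the image
of the circle would lie on a real line through `f(ζ₀)` and could not bound a domain containing that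
point (`not_frontier_subset_line`). The topology of `A` is that of a submultiplicative norm, which
makes Banach algebra tools available. -/

namespace CauchyFormula
open MeasureTheory Metric
open scoped NNReal

/-! ### Increments and integrals of partial derivatives -/

/-- Almost every point of a set of real numbers is an accumulation point of it. -/
theorem ae_accPt (S : Set ℝ) : ∀ᵐ y, y ∈ S → AccPt y (𝓟 S) := by
  have h0 : volume {y | y ∈ S ∧ ¬ AccPt y (𝓟 S)} = 0 := by
    refine measure_null_of_locally_null _ fun y hy => ⟨{y}, ?_, by simp⟩
    obtain ⟨_, h2⟩ := hy
    rw [accPt_iff_nhds] at h2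
    push Not at h2
    obtain ⟨U, hU, hUS⟩ := h2
    exact mem_nhdsWithin_iff_exists_mem_nhds_inter.2 ⟨U, hU, fun z hz => hUS z ⟨hz.1, hz.2.1⟩⟩
  rw [ae_iff]
  simpa using h0

/-- A function that is differentiable at the points of `S` and Lipschitz from these points:
its increment over `[a, b]` is the integral of the derivative over `S`, up to the measure of the
complement. -/
theorem abs_sub_sub_setIntegral_le {g d : ℝ → ℝ} {S : Set ℝ} {a b : ℝ} {N : ℝ≥0} (hab : a ≤ b)
    (hS : MeasurableSet S) (hSab : S ⊆ Icc a b) (hne : S.Nonempty)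
    (hd : ∀ y ∈ S, HasDerivAt g (d y) y)
    (hN : ∀ y ∈ S, ∀ y' ∈ Icc a b, |g y' - g y| ≤ N * |y' - y|) :
    |g b - g a - ∫ y in S, d y| ≤ N * volume.real (Ioc a b \ S) := by
  -- For the pair `a, b`, neither of which need lie in `S`, the bound follows by passing through a
  -- point of `S` between them.
  have hlip : LipschitzOnWith N g (S ∪ {a, b}) := by
    obtain ⟨c, hc⟩ := hne
    have hcab := hSab hc
    have hab' : |g a - g b| ≤ N * |a - b| := by
      calc |g a - g b| ≤ |g a - g c| + |g b - g c| := by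
            rw [abs_sub_comm (g b)]; exact abs_sub_le _ _ _
        _ ≤ N * |a - c| + N * |b - c| :=
            add_le_add (hN c hc a (by simp [hab])) (hN c hc b (by simp [hab]))
        _ = N * |a - b| := by
            rw [abs_of_nonpos (by linarith [hcab.1] : a - c ≤ 0),
              abs_of_nonneg (by linarith [hcab.2] : 0 ≤ b - c),
              abs_of_nonpos (by linarith : a - b ≤ 0)]
            ring
    have hsub : S ∪ {a, b} ⊆ Icc a b := by
      apply union_subset hSab
      rintro x (rfl | rfl) <;> simp [hab]
    refine LipschitzOnWith.of_dist_le_mul fun x hx y hy => ?_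
    rw [Real.dist_eq, Real.dist_eq]
    rcases hy with hy | hy
    · exact hN y hy x (hsub hx)
    · rcases hx with hx | hx
      · rw [abs_sub_comm, abs_sub_comm x]
        exact hN x hx y (hsub (Or.inr hy))
      · rcases hx with rfl | rfl <;> rcases hy with rfl | rfl
        · simp
        · exact hab'
        · rw [abs_sub_comm, abs_sub_comm x]
          exact hab'
        · simp
  -- The extension `G` is absolutely continuous, so its derivative integrates to the increment.
  -- Almost everywhere on `S` this derivative is `d`, since at accumulation points of `S` the
  -- derivative within `S` is unique; off `S` it is at most `N`.
  obtain ⟨G, hG, hGg⟩ := hlip.extend_real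
  have hbound : ∀ y, ‖deriv G y‖ ≤ N := fun y => norm_deriv_le_of_lipschitz hG
  have hint : ∫ y in a..b, deriv G y = g b - g a := by
    rw [(hG.lipschitzOnWith (s := uIcc a b)).absolutelyContinuousOnInterval.integral_deriv_eq_sub,
      ← hGg (by simp), ← hGg (by simp)]
  have hae : ∀ᵐ y, y ∈ S → deriv G y = d y := by
    filter_upwards [ae_accPt S, hG.ae_differentiableAt] with y hy hGy hyS
    have hu : UniqueDiffWithinAt ℝ S y := uniqueDiffWithinAt_iff_accPt.2 (hy hyS)
    have h1 : HasDerivWithinAt g (deriv G y) S y :=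
      hGy.hasDerivAt.hasDerivWithinAt.congr (fun z hz => hGg (Or.inl hz)) (hGg (Or.inl hyS))
    exact hu.eq_deriv _ h1 (hd y hyS).hasDerivWithinAt
  have hi : ∀ s ⊆ Icc a b, IntegrableOn (deriv G) s := fun s hs =>
    IntegrableOn.of_bound ((measure_mono hs).trans_lt (by simp))
      (measurable_deriv G).aestronglyMeasurable N (Eventually.of_forall hbound)
  have hS' : ∫ y in S, d y = ∫ y in S ∩ Ioc a b, deriv G y := by
    rw [← setIntegral_congr_ae hS hae]
    refine setIntegral_congr_set ?_
    have : (S ∩ Icc a b : Set ℝ) =ᵐ[volume] (S ∩ Ioc a b : Set ℝ) :=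
      (EventuallyEq.refl _ _).inter Ioc_ae_eq_Icc.symm
    rwa [inter_eq_left.2 hSab] at this
  have hsplit := integral_inter_add_sdiff (f := deriv G) (s := Ioc a b) hS
    (hi _ Ioc_subset_Icc_self)
  rw [← hint, intervalIntegral.integral_of_le hab, ← hsplit, hS', inter_comm, add_sub_cancel_left,
    ← Real.norm_eq_abs]
  exact norm_setIntegral_le_of_norm_le_const
    ((measure_mono (sdiff_subset.trans Ioc_subset_Icc_self)).trans_lt (by simp))
    (fun y _ => hbound y)

theorem integral_eq_setIntegral_slices {F : Set (ℝ × ℝ)} {f : ℝ × ℝ → ℝ} {a b : ℝ} (hab : a ≤ b)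
    (hF : MeasurableSet F) (hFab : ∀ z ∈ F, z.1 ∈ Icc a b) (hf : IntegrableOn f F) :
    IntervalIntegrable (fun x => ∫ y in {y | (x, y) ∈ F}, f (x, y)) volume a b ∧
    ∫ z in F, f z = ∫ x in a..b, ∫ y in {y | (x, y) ∈ F}, f (x, y) := by
  have hi : Integrable (F.indicator f) (volume.prod volume) := by
    rw [← Measure.volume_eq_prod]
    exact hf.integrable_indicator hF
  have hs : ∀ x, MeasurableSet {y | (x, y) ∈ F} := fun x => measurable_prodMk_left hF
  have hin : ∀ x, ∫ y, F.indicator f (x, y) = ∫ y in {y | (x, y) ∈ F}, f (x, y) := fun x => by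
    rw [← integral_indicator (hs x)]
    rfl
  have h2 := hi.integral_prod_left
  simp only [hin] at h2
  refine ⟨h2.intervalIntegrable, ?_⟩
  rw [← integral_indicator hF, Measure.volume_eq_prod, integral_prod _ hi,
    intervalIntegral.integral_of_le hab, ← integral_Icc_eq_integral_Ioc]
  simp only [hin]
  refine (setIntegral_eq_integral_of_forall_compl_eq_zero fun x hx => ?_).symm
  have : {y | (x, y) ∈ F} = ∅ := eq_empty_of_forall_notMem fun y hy => hx (hFab _ hy)
  rw [this, setIntegral_empty]

/-- On `F` the partial derivative is a pointwise limit of continuous difference quotients, hence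
measurable; it is bounded and `F` has finite measure. -/
theorem integrableOn_partialDeriv {w D : ℝ × ℝ → ℝ} {F : Set (ℝ × ℝ)} {N : ℝ}
    (hw : Continuous w) (hF : IsCompact F)
    (hd : ∀ z ∈ F, HasDerivAt (fun y => w (z.1, y)) (D z) z.2) (hD : ∀ z ∈ F, |D z| ≤ N) :
    IntegrableOn D F := by
  have hm : Measurable (F.indicator D) := by
    refine measurable_of_tendsto_metrizable (f := fun n : ℕ => F.indicator fun z : ℝ × ℝ =>
      ((n : ℝ) + 1) * (w (z.1, z.2 + 1 / ((n : ℝ) + 1)) - w z)) (fun n => ?_) ?_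
    · exact Measurable.indicator (by fun_prop) hF.measurableSet
    · rw [tendsto_pi_nhds]
      intro z
      by_cases hz : z ∈ F
      · simp only [indicator_of_mem hz]
        have h1 := (hd z hz).tendsto_slope_zero_right
        have h2 : Tendsto (fun n : ℕ => 1 / ((n : ℝ) + 1)) atTop (𝓝[>] 0) :=
          tendsto_nhdsWithin_iff.2 ⟨tendsto_one_div_add_atTop_nhds_zero_nat,
            Eventually.of_forall fun n => mem_Ioi.2 (by positivity)⟩
        refine (h1.comp h2).congr fun n => ?_
        simp
      · simp [indicator_of_notMem hz]
  refine (integrable_indicator_iff hF.measurableSet).1 ?_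
  refine Integrable.mono' (g := F.indicator fun _ => N) ?_ hm.aestronglyMeasurable
    (Eventually.of_forall fun z => ?_)
  · exact (integrable_indicator_iff hF.measurableSet).2
      (integrableOn_const hF.measure_lt_top.ne)
  · by_cases hz : z ∈ F
    · simpa [indicator_of_mem hz] using hD z hz
    · simp [indicator_of_notMem hz]

/-- A function `w` on a rectangle `[A₁, B₁] × [A₂, B₂]` that is Lipschitz along the axes from the
points of `F`: its increment across the bounding box of `F`, in the second variable, is the
integral of the partial derivative over `F`, up to the measure of the complement of `F`. -/
theorem abs_integral_sub_setIntegral_le {w D : ℝ × ℝ → ℝ} {F : Set (ℝ × ℝ)}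
    {A₁ B₁ A₂ B₂ a₁ b₁ a₂ b₂ p q : ℝ} {N : ℝ≥0} (hw : Continuous w) (hF : IsCompact F)
    (hFR : F ⊆ Icc a₁ b₁ ×ˢ Icc a₂ b₂) (hA₁ : A₁ ≤ a₁) (hB₁ : b₁ ≤ B₁) (hA₂ : A₂ ≤ a₂)
    (hB₂ : b₂ ≤ B₂) (hAB₂ : A₂ < B₂) (hp : (p, b₂) ∈ F) (hq : (q, a₂) ∈ F)
    (hd : ∀ z ∈ F, HasDerivAt (fun y => w (z.1, y)) (D z) z.2) (hD : ∀ z ∈ F, |D z| ≤ N)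
    (hN₁ : ∀ z ∈ F, ∀ x ∈ Icc A₁ B₁, |w (x, z.2) - w z| ≤ N * |x - z.1|)
    (hN₂ : ∀ z ∈ F, ∀ y ∈ Icc A₂ B₂, |w (z.1, y) - w z| ≤ N * |y - z.2|) :
    |(∫ x in a₁..b₁, (w (x, b₂) - w (x, a₂))) - ∫ z in F, D z| ≤
      N * (3 * ((B₁ - A₁) / (B₂ - A₂)) + 1) *
        volume.real ((Ioc A₁ B₁ ×ˢ Ioc A₂ B₂) \ F) := by
  have hpR := hFR hp
  have hqR := hFR hq
  simp only [mem_prod, mem_Icc] at hpR hqR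
  have ha₁ : a₁ ≤ b₁ := by linarith
  have ha₂ : a₂ ≤ b₂ := by linarith
  set C : ℝ := N * (3 * ((B₁ - A₁) / (B₂ - A₂)) + 1) with hC
  have hr : 0 ≤ (B₁ - A₁) / (B₂ - A₂) := div_nonneg (by linarith) (by linarith)
  have hNC : (N : ℝ) ≤ C := by
    rw [hC]
    exact le_mul_of_one_le_right N.2 (by linarith)
  have hC0 : 0 ≤ C := N.2.trans hNC
  set T : Set (ℝ × ℝ) := (Ioc A₁ B₁ ×ˢ Ioc A₂ B₂) \ F with hT
  have hTm : MeasurableSet T :=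
    (measurableSet_Ioc.prod measurableSet_Ioc).diff hF.measurableSet
  have hTfin : volume T ≠ ⊤ := by
    refine ((measure_mono (sdiff_subset.trans
      (Set.prod_mono Ioc_subset_Icc_self Ioc_subset_Icc_self))).trans_lt ?_).ne
    exact (isCompact_Icc.prod isCompact_Icc).measure_lt_top
  obtain ⟨hDi, hDe⟩ := integral_eq_setIntegral_slices ha₁ hF.measurableSet
    (fun z hz => (hFR hz).1) (integrableOn_partialDeriv hw hF hd hD)
  obtain ⟨hTi, hTe⟩ := integral_eq_setIntegral_slices (f := fun _ => 1) (a := A₁) (b := B₁)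
    (by linarith) hTm (fun z hz => Ioc_subset_Icc_self hz.1.1) (integrableOn_const hTfin)
  have hpt : ∀ x ∈ Ioc a₁ b₁, ‖w (x, b₂) - w (x, a₂) - ∫ y in {y | (x, y) ∈ F}, D (x, y)‖ ≤
      C * ∫ y in {y | (x, y) ∈ T}, (1 : ℝ) := by
    intro x hx
    have hTx : {y | (x, y) ∈ T} = Ioc A₂ B₂ \ {y | (x, y) ∈ F} := by
      ext y
      have : x ∈ Ioc A₁ B₁ := ⟨by linarith [hx.1], by linarith [hx.2]⟩
      simp [hT, this.1, this.2]
    rw [setIntegral_const, smul_eq_mul, mul_one, hTx, Real.norm_eq_abs]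
    have hSm : MeasurableSet {y | (x, y) ∈ F} := measurable_prodMk_left hF.measurableSet
    -- If the slice misses `F`, its whole length `B₂ - A₂` counts as complement. The path `(x, b₂)`,
    -- `(p, b₂)`, `(p, a₂)`, `(q, a₂)`, `(x, a₂)` bounds the increment by three horizontal and one
    -- vertical step, whence the constant `C`. If it meets `F`, the one-variable estimate applies.
    rcases {y | (x, y) ∈ F}.eq_empty_or_nonempty with h | h
    · rw [h, setIntegral_empty, sub_zero, sdiff_empty, Real.volume_real_Ioc_of_le hAB₂.le]
      have e1 := hN₁ _ hp x ⟨by linarith [hx.1], by linarith [hx.2]⟩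
      have e2 := hN₁ _ hq x ⟨by linarith [hx.1], by linarith [hx.2]⟩
      have e3 := hN₁ _ hq p ⟨by linarith [hx.1], by linarith [hx.2]⟩
      have e4 := hN₂ _ hp a₂ ⟨hA₂, by linarith⟩
      simp only at e1 e2 e3 e4
      have f1 : |x - p| ≤ B₁ - A₁ := abs_le.2 ⟨by linarith [hx.1], by linarith [hx.2]⟩
      have f2 : |x - q| ≤ B₁ - A₁ := abs_le.2 ⟨by linarith [hx.1], by linarith [hx.2]⟩
      have f3 : |p - q| ≤ B₁ - A₁ := abs_le.2 ⟨by linarith, by linarith⟩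
      have f4 : |a₂ - b₂| ≤ B₂ - A₂ := abs_le.2 ⟨by linarith, by linarith⟩
      have g1 := e1.trans (mul_le_mul_of_nonneg_left f1 N.2)
      have g2 := e2.trans (mul_le_mul_of_nonneg_left f2 N.2)
      have g3 := e3.trans (mul_le_mul_of_nonneg_left f3 N.2)
      have g4 := e4.trans (mul_le_mul_of_nonneg_left f4 N.2)
      have hCe : C * (B₂ - A₂) = N * (3 * (B₁ - A₁) + (B₂ - A₂)) := by
        rw [hC]
        field_simp [(sub_pos.2 hAB₂).ne']
      rw [hCe]
      rw [abs_le] at *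
      constructor <;> linarith
    · have hSab : {y | (x, y) ∈ F} ⊆ Icc a₂ b₂ := fun y hy => (hFR hy).2
      refine (abs_sub_sub_setIntegral_le (g := fun y => w (x, y)) ha₂ hSm hSab h
        (fun y hy => hd _ hy)
        (fun y hy y' hy' => hN₂ _ hy y' ⟨hA₂.trans hy'.1, hy'.2.trans hB₂⟩)).trans ?_
      refine mul_le_mul hNC (measureReal_mono
        (sdiff_subset_sdiff_left (Ioc_subset_Ioc hA₂ hB₂)) ?_) measureReal_nonneg hC0
      exact ((measure_mono (sdiff_subset.trans Ioc_subset_Icc_self)).trans_lt (by simp)).ne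
  have hwi : IntervalIntegrable (fun x => w (x, b₂) - w (x, a₂)) volume a₁ b₁ :=
    Continuous.intervalIntegrable (by fun_prop) _ _
  have hTi' : IntervalIntegrable (fun x => C * ∫ y in {y | (x, y) ∈ T}, (1 : ℝ)) volume A₁ B₁ :=
    hTi.const_mul C
  have hsub : uIcc a₁ b₁ ⊆ uIcc A₁ B₁ := by
    rw [uIcc_of_le ha₁, uIcc_of_le (by linarith)]
    exact Icc_subset_Icc hA₁ hB₁
  calc |(∫ x in a₁..b₁, (w (x, b₂) - w (x, a₂))) - ∫ z in F, D z|
      = ‖∫ x in a₁..b₁, (w (x, b₂) - w (x, a₂) - ∫ y in {y | (x, y) ∈ F}, D (x, y))‖ := by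
        rw [hDe, ← intervalIntegral.integral_sub hwi hDi, Real.norm_eq_abs]
    _ ≤ ∫ x in a₁..b₁, C * ∫ y in {y | (x, y) ∈ T}, (1 : ℝ) :=
        intervalIntegral.norm_integral_le_of_norm_le ha₁ (Eventually.of_forall hpt)
          (hTi'.mono_set hsub)
    _ ≤ ∫ x in A₁..B₁, C * ∫ y in {y | (x, y) ∈ T}, (1 : ℝ) := by
        refine intervalIntegral.integral_mono_interval hA₁ ha₁ hB₁
          (Eventually.of_forall fun x => ?_) hTi'
        exact mul_nonneg hC0 (integral_nonneg fun _ => zero_le_one)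
    _ = C * volume.real T := by
        rw [intervalIntegral.integral_const_mul, ← hTe, setIntegral_const, smul_eq_mul, mul_one]

/-! ### Boundary integrals of rectangles -/

/-- The integral of `P dx + Q dy` along the boundary of `[x₁, x₂] × [y₁, y₂]`. -/
noncomputable def rectIntegral (P Q : ℝ × ℝ → ℝ) (x₁ x₂ y₁ y₂ : ℝ) : ℝ :=
  (∫ x in x₁..x₂, P (x, y₁)) + (∫ y in y₁..y₂, Q (x₂, y)) - (∫ x in x₁..x₂, P (x, y₂)) -
    ∫ y in y₁..y₂, Q (x₁, y)

theorem rectIntegral_self_fst (P Q : ℝ × ℝ → ℝ) (x y₁ y₂ : ℝ) : rectIntegral P Q x x y₁ y₂ = 0 := by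
  simp [rectIntegral]

theorem rectIntegral_self_snd (P Q : ℝ × ℝ → ℝ) (x₁ x₂ y : ℝ) : rectIntegral P Q x₁ x₂ y y = 0 := by
  simp [rectIntegral]

section

variable {P Q : ℝ × ℝ → ℝ} (hP : Continuous P) (hQ : Continuous Q)

include hP in
theorem rectIntegral_split_fst (x₁ x₂ x₃ y₁ y₂ : ℝ) :
    rectIntegral P Q x₁ x₃ y₁ y₂ = rectIntegral P Q x₁ x₂ y₁ y₂ + rectIntegral P Q x₂ x₃ y₁ y₂ := by
  have h : ∀ y a b, IntervalIntegrable (fun x => P (x, y)) volume a b := fun y a b =>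
    Continuous.intervalIntegrable (by fun_prop) _ _
  simp only [rectIntegral, ← intervalIntegral.integral_add_adjacent_intervals (h y₁ x₁ x₂)
    (h y₁ x₂ x₃), ← intervalIntegral.integral_add_adjacent_intervals (h y₂ x₁ x₂) (h y₂ x₂ x₃)]
  ring

include hQ in
theorem rectIntegral_split_snd (x₁ x₂ y₁ y₂ y₃ : ℝ) :
    rectIntegral P Q x₁ x₂ y₁ y₃ = rectIntegral P Q x₁ x₂ y₁ y₂ + rectIntegral P Q x₁ x₂ y₂ y₃ := by
  have h : ∀ x a b, IntervalIntegrable (fun y => Q (x, y)) volume a b := fun y a b =>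
    Continuous.intervalIntegrable (by fun_prop) _ _
  simp only [rectIntegral, ← intervalIntegral.integral_add_adjacent_intervals (h x₁ y₁ y₂)
    (h x₁ y₂ y₃), ← intervalIntegral.integral_add_adjacent_intervals (h x₂ y₁ y₂) (h x₂ y₂ y₃)]
  ring

include hP hQ

theorem rectIntegral_split_mid (x₁ x₂ y₁ y₂ m n : ℝ) :
    rectIntegral P Q x₁ x₂ y₁ y₂ =
      rectIntegral P Q x₁ m y₁ n + rectIntegral P Q x₁ m n y₂ +
        (rectIntegral P Q m x₂ y₁ n + rectIntegral P Q m x₂ n y₂) := by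
  rw [rectIntegral_split_fst hP x₁ m x₂, rectIntegral_split_snd hQ x₁ m y₁ n y₂,
    rectIntegral_split_snd hQ m x₂ y₁ n y₂]

theorem tendsto_rectIntegral_shrink (x₁ x₂ y₁ y₂ : ℝ) :
    Tendsto (fun δ => rectIntegral P Q (x₁ + δ) (x₂ - δ) (y₁ + δ) (y₂ - δ)) (𝓝 0)
      (𝓝 (rectIntegral P Q x₁ x₂ y₁ y₂)) := by
  have key : ∀ f : ℝ → ℝ → ℝ, Continuous (Function.uncurry f) → ∀ u v : ℝ → ℝ, Continuous u →
      Continuous v → Continuous fun δ => ∫ x in u δ..v δ, f δ x := by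
    intro f hf u v hu hv
    have h : ∀ δ, ∫ x in u δ..v δ, f δ x = (∫ x in 0..v δ, f δ x) - ∫ x in 0..u δ, f δ x := by
      intro δ
      have hc : Continuous (f δ) := by fun_prop
      exact (intervalIntegral.integral_interval_sub_left (hc.intervalIntegrable _ _)
        (hc.intervalIntegrable _ _)).symm
    simp only [h]
    exact (intervalIntegral.continuous_parametric_intervalIntegral_of_continuous hf hv).sub
      (intervalIntegral.continuous_parametric_intervalIntegral_of_continuous hf hu)
  have : Continuous fun δ => rectIntegral P Q (x₁ + δ) (x₂ - δ) (y₁ + δ) (y₂ - δ) := by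
    unfold rectIntegral
    exact (((key (fun δ x => P (x, y₁ + δ)) (by fun_prop) _ _ (by fun_prop) (by fun_prop)).add
      (key (fun δ y => Q (x₂ - δ, y)) (by fun_prop) _ _ (by fun_prop) (by fun_prop))).sub
      (key (fun δ x => P (x, y₂ - δ)) (by fun_prop) _ _ (by fun_prop) (by fun_prop))).sub
      (key (fun δ y => Q (x₁ + δ, y)) (by fun_prop) _ _ (by fun_prop) (by fun_prop))
  simpa using this.tendsto 0

end

/-- The points near which `P dx + Q dy` has zero integral along the boundaries of rectangles. -/
def closedAt (P Q : ℝ × ℝ → ℝ) : Set (ℝ × ℝ) :=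
  {z | ∃ r > 0, ∀ x₁ x₂ y₁ y₂ : ℝ, x₁ ≤ x₂ → y₁ ≤ y₂ → Icc x₁ x₂ ×ˢ Icc y₁ y₂ ⊆ ball z r →
    rectIntegral P Q x₁ x₂ y₁ y₂ = 0}

theorem isOpen_closedAt (P Q : ℝ × ℝ → ℝ) : IsOpen (closedAt P Q) := by
  rw [Metric.isOpen_iff]
  rintro z ⟨r, hr, h⟩
  refine ⟨r, hr, fun z' hz' => ⟨r - dist z' z, by simpa using hz', ?_⟩⟩
  intro x₁ x₂ y₁ y₂ hx hy hR
  exact h _ _ _ _ hx hy (hR.trans (ball_subset_ball' (by linarith)))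

theorem Icc_prod_subset_ball {x₁ x₂ y₁ y₂ δ δ' : ℝ} (hδ : δ < δ') (hx : x₂ - x₁ ≤ δ)
    (hy : y₂ - y₁ ≤ δ) : Icc x₁ x₂ ×ˢ Icc y₁ y₂ ⊆ ball (x₁, y₁) δ' := by
  rintro ⟨x, y⟩ ⟨h1, h2⟩
  simp only [mem_Icc] at h1 h2
  rw [mem_ball, Prod.dist_eq, max_lt_iff, Real.dist_eq, Real.dist_eq]
  exact ⟨abs_lt.2 ⟨by linarith, by linarith⟩, abs_lt.2 ⟨by linarith, by linarith⟩⟩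

section

variable {P Q : ℝ × ℝ → ℝ} (hP : Continuous P) (hQ : Continuous Q)
include hP hQ

/-- Quadrisection reduces the claim to cells smaller than a Lebesgue number of the cover by the
balls of the definition, and boundary integrals add up. -/
theorem rectIntegral_eq_zero_of_subset_closedAt {x₁ x₂ y₁ y₂ : ℝ} (hx : x₁ ≤ x₂) (hy : y₁ ≤ y₂)
    (h : Icc x₁ x₂ ×ˢ Icc y₁ y₂ ⊆ closedAt P Q) : rectIntegral P Q x₁ x₂ y₁ y₂ = 0 := by
  have h' : ∀ z ∈ Icc x₁ x₂ ×ˢ Icc y₁ y₂, ∃ r > 0, ∀ x₁ x₂ y₁ y₂ : ℝ, x₁ ≤ x₂ → y₁ ≤ y₂ →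
      Icc x₁ x₂ ×ˢ Icc y₁ y₂ ⊆ ball z r → rectIntegral P Q x₁ x₂ y₁ y₂ = 0 := fun z hz => h hz
  choose! r hr hW using h'
  obtain ⟨δ, hδ, hleb⟩ := lebesgue_number_lemma_of_metric
    (s := Icc x₁ x₂ ×ˢ Icc y₁ y₂) (c := fun z : ↥(Icc x₁ x₂ ×ˢ Icc y₁ y₂) => ball z (r z))
    (isCompact_Icc.prod isCompact_Icc) (fun _ => isOpen_ball)
    (fun z hz => mem_iUnion.2 ⟨⟨z, hz⟩, mem_ball_self (hr z hz)⟩)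
  have key : ∀ n : ℕ, ∀ a₁ b₁ a₂ b₂, x₁ ≤ a₁ → a₁ ≤ b₁ → b₁ ≤ x₂ → y₁ ≤ a₂ → a₂ ≤ b₂ → b₂ ≤ y₂ →
      b₁ - a₁ ≤ 2 ^ n * (δ / 2) → b₂ - a₂ ≤ 2 ^ n * (δ / 2) →
      rectIntegral P Q a₁ b₁ a₂ b₂ = 0 := by
    intro n
    induction n with
    | zero =>
      intro a₁ b₁ a₂ b₂ h1 h2 h3 h4 h5 h6 h7 h8
      rw [pow_zero, one_mul] at h7 h8
      obtain ⟨z, hz⟩ := hleb (a₁, a₂) ⟨⟨h1, h2.trans h3⟩, ⟨h4, h5.trans h6⟩⟩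
      exact hW z z.2 _ _ _ _ h2 h5
        ((Icc_prod_subset_ball (half_lt_self hδ) h7 h8).trans hz)
    | succ n ih =>
      intro a₁ b₁ a₂ b₂ h1 h2 h3 h4 h5 h6 h7 h8
      rw [pow_succ] at h7 h8
      rw [rectIntegral_split_mid hP hQ a₁ b₁ a₂ b₂ ((a₁ + b₁) / 2) ((a₂ + b₂) / 2),
        ih, ih, ih, ih] <;> linarith
  obtain ⟨n, hn⟩ := pow_unbounded_of_one_lt (max (x₂ - x₁) (y₂ - y₁) / (δ / 2)) one_lt_two
  rw [div_lt_iff₀ (half_pos hδ), max_lt_iff] at hn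
  exact key n _ _ _ _ le_rfl hx le_rfl le_rfl hy le_rfl hn.1.le hn.2.le

/-- The boundary integral is the limit of those over slightly smaller concentric rectangles, so bad
points on the boundary do no harm. -/
theorem rectIntegral_eq_zero_of_Ioo_subset {x₁ x₂ y₁ y₂ : ℝ} (hx : x₁ ≤ x₂) (hy : y₁ ≤ y₂)
    (h : Ioo x₁ x₂ ×ˢ Ioo y₁ y₂ ⊆ closedAt P Q) : rectIntegral P Q x₁ x₂ y₁ y₂ = 0 := by
  rcases hx.eq_or_lt with rfl | hx
  · exact rectIntegral_self_fst _ _ _ _ _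
  rcases hy.eq_or_lt with rfl | hy
  · exact rectIntegral_self_snd _ _ _ _ _
  refine tendsto_nhds_unique
    ((tendsto_rectIntegral_shrink hP hQ x₁ x₂ y₁ y₂).mono_left nhdsWithin_le_nhds)
    (tendsto_const_nhds.congr' (f₁ := fun _ => 0) (l₁ := 𝓝[>] (0 : ℝ)) ?_)
  have h1 : Ioo 0 (min ((x₂ - x₁) / 2) ((y₂ - y₁) / 2)) ∈ 𝓝[>] (0 : ℝ) :=
    Ioo_mem_nhdsGT (lt_min (by linarith) (by linarith))
  filter_upwards [h1] with δ hδ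
  have h2 := lt_min_iff.1 hδ.2
  have h3 := hδ.1
  refine (rectIntegral_eq_zero_of_subset_closedAt hP hQ (by linarith) (by linarith)
    (Subset.trans (Set.prod_mono ?_ ?_) h)).symm
  · exact Icc_subset_Ioo (by linarith) (by linarith)
  · exact Icc_subset_Ioo (by linarith) (by linarith)

/-! ### The Looman–Menchoff theorem -/

/-- The integral along the boundary of a rectangle is bounded by the measure of the part of the
rectangle near whose points `P dx + Q dy` is closed, if `P` and `Q` are Lipschitz along the axes
from the remaining points. -/
theorem abs_rectIntegral_le {D : ℝ × ℝ → ℝ} {F : Set (ℝ × ℝ)} {A₁ B₁ A₂ B₂ : ℝ} {N : ℝ≥0}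
    (hAB₁ : A₁ < B₁) (hAB₂ : A₂ < B₂) (hF : IsCompact F) (hne : F.Nonempty)
    (hFR : F ⊆ Icc A₁ B₁ ×ˢ Icc A₂ B₂) (hgood : (Icc A₁ B₁ ×ˢ Icc A₂ B₂) \ F ⊆ closedAt P Q)
    (hdP : ∀ z ∈ F, HasDerivAt (fun y => P (z.1, y)) (D z) z.2)
    (hdQ : ∀ z ∈ F, HasDerivAt (fun x => Q (x, z.2)) (D z) z.1) (hD : ∀ z ∈ F, |D z| ≤ N)
    (hP₁ : ∀ z ∈ F, ∀ x ∈ Icc A₁ B₁, |P (x, z.2) - P z| ≤ N * |x - z.1|)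
    (hP₂ : ∀ z ∈ F, ∀ y ∈ Icc A₂ B₂, |P (z.1, y) - P z| ≤ N * |y - z.2|)
    (hQ₁ : ∀ z ∈ F, ∀ x ∈ Icc A₁ B₁, |Q (x, z.2) - Q z| ≤ N * |x - z.1|)
    (hQ₂ : ∀ z ∈ F, ∀ y ∈ Icc A₂ B₂, |Q (z.1, y) - Q z| ≤ N * |y - z.2|) :
    |rectIntegral P Q A₁ B₁ A₂ B₂| ≤
      N * (3 * ((B₁ - A₁) / (B₂ - A₂)) + 3 * ((B₂ - A₂) / (B₁ - A₁)) + 2) *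
        volume.real ((Ioc A₁ B₁ ×ˢ Ioc A₂ B₂) \ F) := by
  obtain ⟨u, huF, hu⟩ := hF.exists_isMinOn hne continuous_fst.continuousOn
  obtain ⟨v, hvF, hv⟩ := hF.exists_isMaxOn hne continuous_fst.continuousOn
  obtain ⟨s, hsF, hs⟩ := hF.exists_isMinOn hne continuous_snd.continuousOn
  obtain ⟨t, htF, ht⟩ := hF.exists_isMaxOn hne continuous_snd.continuousOn
  rw [isMinOn_iff] at hu hs
  rw [isMaxOn_iff] at hv ht
  have hFbox : F ⊆ Icc u.1 v.1 ×ˢ Icc s.2 t.2 := fun z hz =>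
    ⟨⟨hu z hz, hv z hz⟩, ⟨hs z hz, ht z hz⟩⟩
  have huv := hu v hvF
  have hst := hs t htF
  have hu' := hFR huF
  have hv' := hFR hvF
  have hs' := hFR hsF
  have ht' := hFR htF
  simp only [mem_prod, mem_Icc] at hu' hv' hs' ht'
  have hz : ∀ a b c d : ℝ, A₁ ≤ a → a ≤ b → b ≤ B₁ → A₂ ≤ c → c ≤ d → d ≤ B₂ →
      (∀ z ∈ F, z ∉ Ioo a b ×ˢ Ioo c d) → rectIntegral P Q a b c d = 0 := by
    intro a b c d h1 h2 h3 h4 h5 h6 h7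
    refine rectIntegral_eq_zero_of_Ioo_subset hP hQ h2 h5 fun z hz =>
      hgood ⟨?_, fun hzF => h7 z hzF hz⟩
    exact ⟨⟨h1.trans hz.1.1.le, hz.1.2.le.trans h3⟩, ⟨h4.trans hz.2.1.le, hz.2.2.le.trans h6⟩⟩
  -- The four rectangles around the bounding box of `F` have no point of `F` in their interior, so
  -- only the box contributes. The extremal points `u, v, s, t` put a point of `F` on each of its
  -- sides, as the slice estimate requires.
  have hW : rectIntegral P Q A₁ B₁ A₂ B₂ = rectIntegral P Q u.1 v.1 s.2 t.2 := by
    rw [rectIntegral_split_fst hP A₁ u.1 B₁, rectIntegral_split_fst hP u.1 v.1 B₁,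
      rectIntegral_split_snd hQ u.1 v.1 A₂ s.2 B₂,
      rectIntegral_split_snd hQ u.1 v.1 s.2 t.2 B₂,
      hz A₁ u.1 A₂ B₂, hz v.1 B₁ A₂ B₂, hz u.1 v.1 A₂ s.2, hz u.1 v.1 t.2 B₂]
    · ring
    all_goals first
      | linarith
      | (intro z hzF hz
         have := hFbox hzF
         simp only [mem_prod, mem_Icc, mem_Ioo] at this hz
         linarith)
  have e1 := abs_integral_sub_setIntegral_le hP hF hFbox hu'.1.1 hv'.1.2 hs'.2.1 ht'.2.2 hAB₂
    (p := t.1) (q := s.1) htF hsF hdP hD hP₁ hP₂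
  have hmp : MeasurePreserving (Prod.swap : ℝ × ℝ → ℝ × ℝ) volume volume := by
    rw [Measure.volume_eq_prod]
    exact Measure.measurePreserving_swap
  have hme : MeasurableEmbedding (Prod.swap : ℝ × ℝ → ℝ × ℝ) :=
    MeasurableEquiv.prodComm.measurableEmbedding
  have hF' : IsCompact (Prod.swap ⁻¹' F) := by
    rw [← image_swap_eq_preimage_swap]
    exact hF.image continuous_swap
  -- The same estimate with the axes exchanged. Both compare with the integral of the same `D` over
  -- `F`, which cancels in the boundary integral.
  have e2 := abs_integral_sub_setIntegral_le (w := Q ∘ Prod.swap) (D := D ∘ Prod.swap)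
    (F := Prod.swap ⁻¹' F) (hQ.comp continuous_swap) hF' (a₁ := s.2) (b₁ := t.2) (a₂ := u.1)
    (b₂ := v.1) (fun z hz => ⟨(hFbox hz).2, (hFbox hz).1⟩) hs'.2.1 ht'.2.2 hu'.1.1 hv'.1.2 hAB₁
    (p := v.2) (q := u.2) hvF huF (fun z hz => hdQ _ hz) (fun z hz => hD _ hz)
    (fun z hz => hQ₂ _ hz) (fun z hz => hQ₁ _ hz)
  have hvol : volume.real ((Ioc A₂ B₂ ×ˢ Ioc A₁ B₁) \ Prod.swap ⁻¹' F) =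
      volume.real ((Ioc A₁ B₁ ×ˢ Ioc A₂ B₂) \ F) := by
    rw [← preimage_swap_prod, ← preimage_sdiff, measureReal_def, measureReal_def,
      hmp.measure_preimage_emb hme]
  have hint : ∫ z in Prod.swap ⁻¹' F, (D ∘ Prod.swap) z = ∫ z in F, D z :=
    hmp.setIntegral_preimage_emb hme D F
  rw [hvol, hint] at e2
  have hPi : ∀ y a b, IntervalIntegrable (fun x => P (x, y)) volume a b := fun y a b =>
    Continuous.intervalIntegrable (by fun_prop) _ _
  have hQi : ∀ x a b, IntervalIntegrable (fun y => Q (x, y)) volume a b := fun y a b =>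
    Continuous.intervalIntegrable (by fun_prop) _ _
  simp only [Function.comp_apply, Prod.swap_prod_mk] at e2
  rw [intervalIntegral.integral_sub (hPi _ _ _) (hPi _ _ _)] at e1
  rw [intervalIntegral.integral_sub (hQi _ _ _) (hQi _ _ _)] at e2
  rw [hW, rectIntegral]
  set V := volume.real ((Ioc A₁ B₁ ×ˢ Ioc A₂ B₂) \ F)
  have hsum : N * (3 * ((B₁ - A₁) / (B₂ - A₂)) + 3 * ((B₂ - A₂) / (B₁ - A₁)) + 2) * V =
      N * (3 * ((B₁ - A₁) / (B₂ - A₂)) + 1) * V + N * (3 * ((B₂ - A₂) / (B₁ - A₁)) + 1) * V := by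
    ring
  rw [hsum]
  rw [abs_le] at *
  constructor <;> linarith

end

/-- If the boundary integrals vanish for the rectangles that do not meet `K` and are at most
`C` times the measure of the complement of `K` for the rectangles of a fixed shape, then they
vanish. -/
theorem rectIntegral_eq_zero_of_abs_le {P Q : ℝ × ℝ → ℝ} (hP : Continuous P) (hQ : Continuous Q)
    {K : Set (ℝ × ℝ)} (hK : IsCompact K) {x₁ x₂ y₁ y₂ C : ℝ} (hx : x₁ < x₂) (hy : y₁ < y₂)
    (hC : 0 ≤ C)
    (h0 : ∀ a₁ b₁ a₂ b₂, x₁ ≤ a₁ → a₁ < b₁ → b₁ ≤ x₂ → y₁ ≤ a₂ → a₂ < b₂ → b₂ ≤ y₂ →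
      Disjoint (Icc a₁ b₁ ×ˢ Icc a₂ b₂) K → rectIntegral P Q a₁ b₁ a₂ b₂ = 0)
    (h1 : ∀ a₁ b₁ a₂ b₂, x₁ ≤ a₁ → a₁ < b₁ → b₁ ≤ x₂ → y₁ ≤ a₂ → a₂ < b₂ → b₂ ≤ y₂ →
      (b₁ - a₁) * (y₂ - y₁) = (b₂ - a₂) * (x₂ - x₁) →
      ((Icc a₁ b₁ ×ˢ Icc a₂ b₂) ∩ K).Nonempty →
      |rectIntegral P Q a₁ b₁ a₂ b₂| ≤ C * volume.real ((Ioc a₁ b₁ ×ˢ Ioc a₂ b₂) \ K)) :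
    rectIntegral P Q x₁ x₂ y₁ y₂ = 0 := by
  have hfin : ∀ a b c d : ℝ, ∀ T : Set (ℝ × ℝ), volume ((Ioc a b ×ˢ Ioc c d) ∩ T) ≠ ⊤ := by
    intro a b c d T
    refine ((measure_mono (inter_subset_left.trans
      (Set.prod_mono Ioc_subset_Icc_self Ioc_subset_Icc_self))).trans_lt ?_).ne
    exact (isCompact_Icc.prod isCompact_Icc).measure_lt_top
  -- A cell with sides at most `η` that meets `K` lies in the `η`-thickening of `K`. The measures of
  -- half-open cells add up exactly under quadrisection, and the thickening minus `K` has measure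
  -- tending to zero with `η`.
  have key : ∀ η > 0, ∀ n : ℕ, ∀ a₁ b₁ a₂ b₂, x₁ ≤ a₁ → a₁ < b₁ → b₁ ≤ x₂ → y₁ ≤ a₂ → a₂ < b₂ →
      b₂ ≤ y₂ → (b₁ - a₁) * (y₂ - y₁) = (b₂ - a₂) * (x₂ - x₁) →
      b₁ - a₁ ≤ 2 ^ n * η → b₂ - a₂ ≤ 2 ^ n * η →
      |rectIntegral P Q a₁ b₁ a₂ b₂| ≤
        C * volume.real ((Ioc a₁ b₁ ×ˢ Ioc a₂ b₂) ∩ (cthickening η K \ K)) := by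
    intro η hη n
    set T := cthickening η K \ K with hT
    have hTm : MeasurableSet T := isClosed_cthickening.measurableSet.diff hK.measurableSet
    induction n with
    | zero =>
      intro a₁ b₁ a₂ b₂ i1 i2 i3 i4 i5 i6 i7 i8 i9
      rw [pow_zero, one_mul] at i8 i9
      rcases ((Icc a₁ b₁ ×ˢ Icc a₂ b₂) ∩ K).eq_empty_or_nonempty with h | ⟨z, hz⟩
      · rw [h0 _ _ _ _ i1 i2 i3 i4 i5 i6 (disjoint_iff_inter_eq_empty.2 h), abs_zero]
        exact mul_nonneg hC measureReal_nonneg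
      · refine (h1 _ _ _ _ i1 i2 i3 i4 i5 i6 i7 ⟨z, hz⟩).trans
          (mul_le_mul_of_nonneg_left (measureReal_mono ?_ (hfin _ _ _ _ _)) hC)
        rintro w ⟨hw, hwK⟩
        refine ⟨hw, ?_, hwK⟩
        refine mem_cthickening_of_dist_le w z _ _ hz.2 ?_
        have hz1 := hz.1
        simp only [mem_prod, mem_Icc, mem_Ioc] at hz1 hw
        rw [Prod.dist_eq, max_le_iff, Real.dist_eq, Real.dist_eq]
        exact ⟨abs_le.2 ⟨by linarith, by linarith⟩, abs_le.2 ⟨by linarith, by linarith⟩⟩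
    | succ n ih =>
      intro a₁ b₁ a₂ b₂ i1 i2 i3 i4 i5 i6 i7 i8 i9
      rw [pow_succ] at i8 i9
      have s1 : ∀ c d : ℝ, volume.real ((Ioc a₁ b₁ ×ˢ Ioc c d) ∩ T) =
          volume.real ((Ioc a₁ ((a₁ + b₁) / 2) ×ˢ Ioc c d) ∩ T) +
          volume.real ((Ioc ((a₁ + b₁) / 2) b₁ ×ˢ Ioc c d) ∩ T) := by
        intro c d
        rw [← measureReal_union _ ((measurableSet_Ioc.prod measurableSet_Ioc).inter hTm)
          (hfin _ _ _ _ _) (hfin _ _ _ _ _), ← union_inter_distrib_right, ← union_prod,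
          Ioc_union_Ioc_eq_Ioc (by linarith) (by linarith)]
        refine Disjoint.inter_left _ (Disjoint.inter_right _ ?_)
        exact Disjoint.set_prod_left (Ioc_disjoint_Ioc_of_le le_rfl) _ _
      have s2 : ∀ c d : ℝ, volume.real ((Ioc c d ×ˢ Ioc a₂ b₂) ∩ T) =
          volume.real ((Ioc c d ×ˢ Ioc a₂ ((a₂ + b₂) / 2)) ∩ T) +
          volume.real ((Ioc c d ×ˢ Ioc ((a₂ + b₂) / 2) b₂) ∩ T) := by
        intro c d
        rw [← measureReal_union _ ((measurableSet_Ioc.prod measurableSet_Ioc).inter hTm)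
          (hfin _ _ _ _ _) (hfin _ _ _ _ _), ← union_inter_distrib_right, ← prod_union,
          Ioc_union_Ioc_eq_Ioc (by linarith) (by linarith)]
        refine Disjoint.inter_left _ (Disjoint.inter_right _ ?_)
        exact Disjoint.set_prod_right (Ioc_disjoint_Ioc_of_le le_rfl) _ _
      rw [rectIntegral_split_mid hP hQ a₁ b₁ a₂ b₂ ((a₁ + b₁) / 2) ((a₂ + b₂) / 2), s1, s2, s2]
      have j1 := ih a₁ ((a₁ + b₁) / 2) a₂ ((a₂ + b₂) / 2) i1 (by linarith) (by linarith) i4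
        (by linarith) (by linarith) (by linarith) (by linarith) (by linarith)
      have j2 := ih a₁ ((a₁ + b₁) / 2) ((a₂ + b₂) / 2) b₂ i1 (by linarith) (by linarith)
        (by linarith) (by linarith) i6 (by linarith) (by linarith) (by linarith)
      have j3 := ih ((a₁ + b₁) / 2) b₁ a₂ ((a₂ + b₂) / 2) (by linarith) (by linarith) i3 i4
        (by linarith) (by linarith) (by linarith) (by linarith) (by linarith)
      have j4 := ih ((a₁ + b₁) / 2) b₁ ((a₂ + b₂) / 2) b₂ (by linarith) (by linarith) i3
        (by linarith) (by linarith) i6 (by linarith) (by linarith) (by linarith)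
      rw [abs_le] at *
      constructor <;> linarith
  have hbound : ∀ η > 0, |rectIntegral P Q x₁ x₂ y₁ y₂| ≤
      C * (volume.real (cthickening η K) - volume.real K) := by
    intro η hη
    obtain ⟨n, hn⟩ := pow_unbounded_of_one_lt (max (x₂ - x₁) (y₂ - y₁) / η) one_lt_two
    rw [div_lt_iff₀ hη, max_lt_iff] at hn
    have hfin' := hK.cthickening (r := η).measure_lt_top (μ := volume)
    refine (key η hη n _ _ _ _ le_rfl hx le_rfl le_rfl hy le_rfl (mul_comm _ _) hn.1.le
      hn.2.le).trans (mul_le_mul_of_nonneg_left ?_ hC)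
    rw [← measureReal_sdiff (self_subset_cthickening K) hK.measurableSet hfin'.ne]
    exact measureReal_mono inter_subset_right
      ((measure_mono sdiff_subset).trans_lt hfin').ne
  have hlim : Tendsto (fun η => C * (volume.real (cthickening η K) - volume.real K)) (𝓝[>] 0)
      (𝓝 (C * (volume.real K - volume.real K))) := by
    refine ((Tendsto.sub_const ?_ _).const_mul C).mono_left nhdsWithin_le_nhds
    exact (ENNReal.tendsto_toReal hK.measure_lt_top.ne).comp
      (tendsto_measure_cthickening_of_isCompact hK)
  rw [sub_self, mul_zero] at hlim
  have := ge_of_tendsto hlim (eventually_mem_nhdsWithin.mono fun η hη => hbound η hη)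
  exact abs_nonpos_iff.1 this

/-- A single integer serves as Lipschitz constant and as inverse scale, and any larger one works
too; this yields the countable closed cover for Baire's theorem. -/
theorem exists_forall_abs_sub_le {f : ℝ → ℝ} {x : ℝ} (hf : DifferentiableAt ℝ f x) :
    ∃ n₀ : ℕ, ∀ n ≥ n₀, ∀ h : ℝ, |h| ≤ 1 / ((n : ℝ) + 1) → |f (x + h) - f x| ≤ n * |h| := by
  obtain ⟨C, hC⟩ := hf.isBigO_sub.bound
  obtain ⟨r, hr, hr'⟩ := Metric.eventually_nhds_iff.1 hC
  obtain ⟨n₁, hn₁⟩ := exists_nat_ge C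
  obtain ⟨n₂, hn₂⟩ := exists_nat_one_div_lt hr
  refine ⟨max n₁ n₂, fun n hn h hh => ?_⟩
  have h2 : 1 / ((n : ℝ) + 1) ≤ 1 / ((n₂ : ℝ) + 1) :=
    Nat.one_div_le_one_div ((le_max_right _ _).trans hn)
  have h3 := hr' (y := x + h) (by rw [Real.dist_eq, add_sub_cancel_left]; linarith)
  rw [add_sub_cancel_left, Real.norm_eq_abs, Real.norm_eq_abs] at h3
  have h4 : (n₁ : ℝ) ≤ n := by exact_mod_cast (le_max_left _ _).trans hn
  exact h3.trans (mul_le_mul_of_nonneg_right (hn₁.trans h4) (abs_nonneg _))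

/-- The points from which `P` and `Q` are Lipschitz along the axes, with constant `n` at distances
up to `1 / (n + 1)`. -/
def axisLipschitz (P Q : ℝ × ℝ → ℝ) (n : ℕ) : Set (ℝ × ℝ) :=
  {z | ∀ h : ℝ, |h| ≤ 1 / ((n : ℝ) + 1) →
    |P (z.1 + h, z.2) - P z| ≤ n * |h| ∧ |P (z.1, z.2 + h) - P z| ≤ n * |h| ∧
    |Q (z.1 + h, z.2) - Q z| ≤ n * |h| ∧ |Q (z.1, z.2 + h) - Q z| ≤ n * |h|}

theorem isClosed_axisLipschitz {P Q : ℝ × ℝ → ℝ} (hP : Continuous P) (hQ : Continuous Q) (n : ℕ) :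
    IsClosed (axisLipschitz P Q n) := by
  simp only [axisLipschitz, ofPred_forall, ofPred_and]
  refine isClosed_iInter fun h => isClosed_iInter fun _ => ?_
  refine IsClosed.inter ?_ (IsClosed.inter ?_ (IsClosed.inter ?_ ?_)) <;>
    exact isClosed_le (by fun_prop) continuous_const

/-- **Looman–Menchoff theorem** for differential forms: if `P` and `Q` are continuous and have
partial derivatives at each point of the open set `U`, with `∂P/∂y = ∂Q/∂x`, then the form
`P dx + Q dy` is closed in `U`. -/
theorem subset_closedAt {P Q D : ℝ × ℝ → ℝ} (hP : Continuous P) (hQ : Continuous Q)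
    {U : Set (ℝ × ℝ)} (hU : IsOpen U)
    (hPx : ∀ z ∈ U, DifferentiableAt ℝ (fun x => P (x, z.2)) z.1)
    (hPy : ∀ z ∈ U, HasDerivAt (fun y => P (z.1, y)) (D z) z.2)
    (hQx : ∀ z ∈ U, HasDerivAt (fun x => Q (x, z.2)) (D z) z.1)
    (hQy : ∀ z ∈ U, DifferentiableAt ℝ (fun y => Q (z.1, y)) z.2) :
    U ⊆ closedAt P Q := by
  by_contra hnot
  obtain ⟨z₀, hz₀U, hz₀⟩ := not_subset.1 hnot
  set E : Set (ℝ × ℝ) := U ∩ (closedAt P Q)ᶜ with hE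
  have hlc : IsLocallyClosed E :=
    hU.isLocallyClosed.inter (isOpen_closedAt P Q).isClosed_compl.isLocallyClosed
  -- Local compactness makes `E` a Baire space although it need not be closed in the plane.
  have : LocallyCompactSpace E := hlc.locallyCompactSpace
  have : Nonempty E := ⟨⟨z₀, hz₀U, hz₀⟩⟩
  have hcover : ⋃ n, (Subtype.val ⁻¹' axisLipschitz P Q n : Set E) = univ := by
    refine eq_univ_of_forall fun z => mem_iUnion.2 ?_
    obtain ⟨n₁, h₁⟩ := exists_forall_abs_sub_le (hPx z z.2.1)
    obtain ⟨n₂, h₂⟩ := exists_forall_abs_sub_le (hPy z z.2.1).differentiableAt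
    obtain ⟨n₃, h₃⟩ := exists_forall_abs_sub_le (hQx z z.2.1).differentiableAt
    obtain ⟨n₄, h₄⟩ := exists_forall_abs_sub_le (hQy z z.2.1)
    refine ⟨max (max n₁ n₂) (max n₃ n₄), fun h hh => ?_⟩
    exact ⟨h₁ _ (by simp) h hh, h₂ _ (by simp) h hh, h₃ _ (by simp) h hh, h₄ _ (by simp) h hh⟩
  obtain ⟨n, z₁, hz₁⟩ := nonempty_interior_of_iUnion_of_closed
    (fun n => (isClosed_axisLipschitz hP hQ n).preimage continuous_subtype_val) hcover
  obtain ⟨V', hV', hVo, hz₁V⟩ := mem_interior.1 hz₁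
  obtain ⟨V, hV, rfl⟩ := isOpen_induced_iff.1 hVo
  obtain ⟨ρ, hρ, hρV⟩ := Metric.isOpen_iff.1 (hV.inter hU) z₁ ⟨hz₁V, z₁.2.1⟩
  have hE_lip : ∀ z ∈ E, z ∈ V → z ∈ axisLipschitz P Q n := fun z hzE hzV =>
    hV' (a := ⟨z, hzE⟩) hzV
  have hn0 : (0 : ℝ) < 1 / ((n : ℝ) + 1) := by positivity
  -- Half the scale of `axisLipschitz`, since two points of a ball of radius `r` may differ by
  -- nearly `2 * r` in a coordinate.
  set r := min ρ (1 / ((n : ℝ) + 1) / 2) with hr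
  have hr0 : 0 < r := lt_min hρ (half_pos hn0)
  have hrn : 2 * r ≤ 1 / ((n : ℝ) + 1) := by linarith [min_le_right ρ (1 / ((n : ℝ) + 1) / 2)]
  -- The contradiction is that the bad point `z₁` turns out to lie in `closedAt P Q`.
  refine z₁.2.2 ⟨r, hr0, fun x₁ x₂ y₁ y₂ hx hy hR => ?_⟩
  rcases hx.eq_or_lt with rfl | hx
  · exact rectIntegral_self_fst _ _ _ _ _
  rcases hy.eq_or_lt with rfl | hy
  · exact rectIntegral_self_snd _ _ _ _ _
  set R := Icc x₁ x₂ ×ˢ Icc y₁ y₂ with hRdef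
  have hRVU : R ⊆ V ∩ U := hR.trans ((ball_subset_ball (min_le_left _ _)).trans hρV)
  have hc1 := hR (show (x₁, y₁) ∈ R from ⟨⟨le_rfl, hx.le⟩, ⟨le_rfl, hy.le⟩⟩)
  have hc2 := hR (show (x₂, y₂) ∈ R from ⟨⟨hx.le, le_rfl⟩, ⟨hy.le, le_rfl⟩⟩)
  rw [mem_ball, Prod.dist_eq, max_lt_iff, Real.dist_eq, Real.dist_eq, abs_lt, abs_lt] at hc1 hc2
  simp only at hc1 hc2
  have hK : IsCompact (R ∩ (closedAt P Q)ᶜ) :=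
    (isCompact_Icc.prod isCompact_Icc).inter_right (isOpen_closedAt P Q).isClosed_compl
  set K := R ∩ (closedAt P Q)ᶜ with hKdef
  have hcell : ∀ a₁ b₁ a₂ b₂, x₁ ≤ a₁ → b₁ ≤ x₂ → y₁ ≤ a₂ → b₂ ≤ y₂ →
      Icc a₁ b₁ ×ˢ Icc a₂ b₂ ⊆ R := fun a₁ b₁ a₂ b₂ i1 i3 i4 i6 =>
    Set.prod_mono (Icc_subset_Icc i1 i3) (Icc_subset_Icc i4 i6)
  have hrs : 0 < (x₂ - x₁) / (y₂ - y₁) := div_pos (by linarith) (by linarith)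
  have hrs' : 0 < (y₂ - y₁) / (x₂ - x₁) := div_pos (by linarith) (by linarith)
  refine rectIntegral_eq_zero_of_abs_le hP hQ hK hx hy
    (C := n * (3 * ((x₂ - x₁) / (y₂ - y₁)) + 3 * ((y₂ - y₁) / (x₂ - x₁)) + 2)) (by positivity) ?_ ?_
  · intro a₁ b₁ a₂ b₂ i1 i2 i3 i4 i5 i6 hdis
    refine rectIntegral_eq_zero_of_subset_closedAt hP hQ i2.le i5.le fun z hz => ?_
    by_contra hzc
    exact disjoint_left.1 hdis hz ⟨hcell _ _ _ _ i1 i3 i4 i6 hz, hzc⟩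
  · intro a₁ b₁ a₂ b₂ i1 i2 i3 i4 i5 i6 hasp hne
    have hsub := hcell _ _ _ _ i1 i3 i4 i6
    have hFE : ∀ z ∈ (Icc a₁ b₁ ×ˢ Icc a₂ b₂) ∩ K, z ∈ E := fun z hz =>
      ⟨(hRVU hz.2.1).2, hz.2.2⟩
    have hlip : ∀ z ∈ (Icc a₁ b₁ ×ˢ Icc a₂ b₂) ∩ K, z ∈ axisLipschitz P Q n := fun z hz =>
      hE_lip z (hFE z hz) (hRVU hz.2.1).1
    have e1 : (b₁ - a₁) / (b₂ - a₂) = (x₂ - x₁) / (y₂ - y₁) := by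
      rw [div_eq_div_iff (by linarith) (by linarith), hasp, mul_comm]
    have e2 : (b₂ - a₂) / (b₁ - a₁) = (y₂ - y₁) / (x₂ - x₁) := by
      rw [div_eq_div_iff (by linarith) (by linarith), ← hasp, mul_comm]
    have hdiff : (Ioc a₁ b₁ ×ˢ Ioc a₂ b₂) \ ((Icc a₁ b₁ ×ˢ Icc a₂ b₂) ∩ K) =
        (Ioc a₁ b₁ ×ˢ Ioc a₂ b₂) \ K := by
      ext z
      constructor
      · exact fun hz => ⟨hz.1, fun hzK => hz.2 ⟨⟨Ioc_subset_Icc_self hz.1.1,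
          Ioc_subset_Icc_self hz.1.2⟩, hzK⟩⟩
      · exact fun hz => ⟨hz.1, fun hzK => hz.2 hzK.2⟩
    have hfst : ∀ z ∈ (Icc a₁ b₁ ×ˢ Icc a₂ b₂) ∩ K, ∀ x ∈ Icc a₁ b₁,
        |x - z.1| ≤ 1 / ((n : ℝ) + 1) := by
      intro z hz x hx
      have := hz.1.1
      exact abs_le.2 ⟨by linarith [hx.1, hx.2, this.1, this.2], by
        linarith [hx.1, hx.2, this.1, this.2]⟩
    have hsnd : ∀ z ∈ (Icc a₁ b₁ ×ˢ Icc a₂ b₂) ∩ K, ∀ y ∈ Icc a₂ b₂,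
        |y - z.2| ≤ 1 / ((n : ℝ) + 1) := by
      intro z hz x hx
      have := hz.1.2
      exact abs_le.2 ⟨by linarith [hx.1, hx.2, this.1, this.2], by
        linarith [hx.1, hx.2, this.1, this.2]⟩
    rw [← e1, ← e2, ← hdiff]
    refine abs_rectIntegral_le (N := n) (D := D) hP hQ i2 i5
      ((isCompact_Icc.prod isCompact_Icc).inter hK) hne inter_subset_left (fun z hz => ?_)
      (fun z hz => hPy z (hFE z hz).1) (fun z hz => hQx z (hFE z hz).1) (fun z hz => ?_)
      (fun z hz x hx => ?_) (fun z hz y hy => ?_) (fun z hz x hx => ?_) (fun z hz y hy => ?_)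
    · by_contra hzc
      exact hz.2 ⟨hz.1, hsub hz.1, hzc⟩
    · refine (hPy z (hFE z hz).1).le_of_lip' (NNReal.coe_nonneg _) ?_
      filter_upwards [closedBall_mem_nhds z.2 hn0] with y hy
      simpa using (hlip z hz (y - z.2) (by simpa [Real.dist_eq] using hy)).2.1
    · simpa using (hlip z hz _ (hfst z hz x hx)).1
    · simpa using (hlip z hz _ (hsnd z hz y hy)).2.1
    · simpa using (hlip z hz _ (hfst z hz x hx)).2.2.1
    · simpa using (hlip z hz _ (hsnd z hz y hy)).2.2.2

/-- Clamping both coordinates to `[0, 1]` extends `P` and `Q` continuously to the plane without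
changing them on the closed square, hence without changing the partial derivatives inside. -/
theorem rectIntegral_unitSquare_eq_zero {P Q D : ℝ × ℝ → ℝ}
    (hP : ContinuousOn P (Icc 0 1 ×ˢ Icc 0 1)) (hQ : ContinuousOn Q (Icc 0 1 ×ˢ Icc 0 1))
    (hPx : ∀ z ∈ Ioo (0 : ℝ) 1 ×ˢ Ioo (0 : ℝ) 1, DifferentiableAt ℝ (fun x => P (x, z.2)) z.1)
    (hPy : ∀ z ∈ Ioo (0 : ℝ) 1 ×ˢ Ioo (0 : ℝ) 1, HasDerivAt (fun y => P (z.1, y)) (D z) z.2)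
    (hQx : ∀ z ∈ Ioo (0 : ℝ) 1 ×ˢ Ioo (0 : ℝ) 1, HasDerivAt (fun x => Q (x, z.2)) (D z) z.1)
    (hQy : ∀ z ∈ Ioo (0 : ℝ) 1 ×ˢ Ioo (0 : ℝ) 1, DifferentiableAt ℝ (fun y => Q (z.1, y)) z.2) :
    rectIntegral P Q 0 1 0 1 = 0 := by
  set c : ℝ → ℝ := fun x => max 0 (min 1 x) with hc
  have hcc : Continuous c := by fun_prop
  have hcm : ∀ x, c x ∈ Icc (0 : ℝ) 1 := fun x => ⟨le_max_left _ _, by simp [hc]⟩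
  have hci : ∀ x ∈ Icc (0 : ℝ) 1, c x = x := fun x hx => by simp [hc, hx.1, hx.2]
  have hext : ∀ f : ℝ × ℝ → ℝ, ContinuousOn f (Icc 0 1 ×ˢ Icc 0 1) →
      Continuous fun z : ℝ × ℝ => f (c z.1, c z.2) := fun f hf =>
    hf.comp_continuous (by fun_prop) fun z => ⟨hcm _, hcm _⟩
  have hloc : ∀ x ∈ Ioo (0 : ℝ) 1, ∀ᶠ x' in 𝓝 x, c x' = x' := fun x hx =>
    Filter.mem_of_superset (Ioo_mem_nhds hx.1 hx.2) fun x' hx' => hci x' (Ioo_subset_Icc_self hx')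
  have hfst : ∀ f : ℝ × ℝ → ℝ, ∀ z ∈ Ioo (0 : ℝ) 1 ×ˢ Ioo (0 : ℝ) 1,
      (fun x => f (c x, c z.2)) =ᶠ[𝓝 z.1] fun x => f (x, z.2) := fun f z hz => by
    filter_upwards [hloc z.1 hz.1] with x hx
    rw [hx, hci _ (Ioo_subset_Icc_self hz.2)]
  have hsnd : ∀ f : ℝ × ℝ → ℝ, ∀ z ∈ Ioo (0 : ℝ) 1 ×ˢ Ioo (0 : ℝ) 1,
      (fun y => f (c z.1, c y)) =ᶠ[𝓝 z.2] fun y => f (z.1, y) := fun f z hz => by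
    filter_upwards [hloc z.2 hz.2] with x hx
    rw [hx, hci _ (Ioo_subset_Icc_self hz.1)]
  have hmain : rectIntegral (fun z => P (c z.1, c z.2)) (fun z => Q (c z.1, c z.2))
      0 1 0 1 = 0 := by
    refine rectIntegral_eq_zero_of_Ioo_subset (hext P hP) (hext Q hQ) zero_le_one zero_le_one
      (subset_closedAt (D := D) (hext P hP) (hext Q hQ) (isOpen_Ioo.prod isOpen_Ioo)
      (fun z hz => ?_) (fun z hz => ?_) (fun z hz => ?_) (fun z hz => ?_))
    · exact (hPx z hz).congr_of_eventuallyEq (hfst P z hz)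
    · exact (hPy z hz).congr_of_eventuallyEq (hsnd P z hz)
    · exact (hQx z hz).congr_of_eventuallyEq (hfst Q z hz)
    · exact (hQy z hz).congr_of_eventuallyEq (hsnd Q z hz)
  refine Eq.trans ?_ hmain
  have h01 : uIcc (0 : ℝ) 1 = Icc 0 1 := uIcc_of_le zero_le_one
  unfold rectIntegral
  congr 1
  · congr 1
    · congr 1
      · refine intervalIntegral.integral_congr fun x hx => ?_
        simp only [hci x (h01 ▸ hx), hci 0 (by simp)]
      · refine intervalIntegral.integral_congr fun x hx => ?_
        simp only [hci x (h01 ▸ hx), hci 1 (by simp)]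
    · refine intervalIntegral.integral_congr fun x hx => ?_
      simp only [hci x (h01 ▸ hx), hci 1 (by simp)]
  · refine intervalIntegral.integral_congr fun x hx => ?_
    simp only [hci x (h01 ▸ hx), hci 0 (by simp)]

/-! ### Cauchy's theorem for triangles -/

section Segment

variable {A E : Type*} [NormedCommRing A] [NormedAlgebra ℝ A] [NormedAddCommGroup E]
  [NormedSpace ℝ E]

/-- `Ψ` is differentiable at the points of `V` in all directions `h`, with derivative
`T h * d`. -/
def HasDirectionalDerivOn (T : E →L[ℝ] A) (V : Set E) (Ψ d : E → A) : Prop :=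
  ∀ x ∈ V, ∀ h : E, HasDerivAt (fun s : ℝ => Ψ (x + s • h)) (T h * d x) 0

theorem HasDirectionalDerivOn.hasDerivAt {T : E →L[ℝ] A} {V : Set E} {Ψ d : E → A}
    (hΨ : HasDirectionalDerivOn T V Ψ d) (x h : E) (s : ℝ) (hs : x + s • h ∈ V) :
    HasDerivAt (fun s : ℝ => Ψ (x + s • h)) (T h * d (x + s • h)) s := by
  have h1 := hΨ _ hs h
  rw [← sub_self s] at h1
  refine (h1.comp_sub_const s s).congr_of_eventuallyEq (Eventually.of_forall fun s' => ?_)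
  simp only [sub_smul]
  congr 1
  abel

/-- The integral of `Ψ dT` along the segment from `x` to `y`. -/
noncomputable def segIntegral (T : E →L[ℝ] A) (Ψ : E → A) (x y : E) : A :=
  ∫ t in (0 : ℝ)..1, Ψ (x + t • (y - x)) * T (y - x)

/-- The map `(s, t) ↦ x + s • (u + t • v)` sends the unit square onto the triangle and collapses the
side `s = 0` to `x`; the other three sides give the three segments. After a real functional `ℓ` is
applied, the pulled-back form is real and the result for the unit square applies. -/
theorem segIntegral_add {T : E →L[ℝ] A} {V : Set E} {Ψ d : E → A} [CompleteSpace A]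
    (hc : ContinuousOn Ψ V) (hΨ : HasDirectionalDerivOn T V Ψ d) (hV : Convex ℝ V) {x y z : E}
    (hx : x ∈ V) (hy : y ∈ V) (hz : z ∈ V) :
    segIntegral T Ψ x y + segIntegral T Ψ y z = segIntegral T Ψ x z := by
  rw [← sub_eq_zero]
  refine SeparatingDual.eq_zero_of_forall_dual_eq_zero (R := ℝ) fun ℓ => ?_
  set u := y - x with hu
  set v := z - y with hv
  have hφ : ∀ s ∈ Icc (0 : ℝ) 1, ∀ t ∈ Icc (0 : ℝ) 1, x + s • (u + t • v) ∈ V := by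
    intro s hs t ht
    have h1 := hV.add_smul_sub_mem hx (hV.add_smul_sub_mem hy hz ht) hs
    have h2 : x + s • (y + t • (z - y) - x) = x + s • (u + t • v) := by
      rw [hu, hv]
      congr 2
      abel
    rwa [h2] at h1
  have hφc : ContinuousOn (fun p : ℝ × ℝ => Ψ (x + p.1 • (u + p.2 • v)))
      (Icc 0 1 ×ˢ Icc 0 1) :=
    hc.comp (by fun_prop) fun p hp => hφ _ hp.1 _ hp.2
  have hint : ∀ a b : E, a ∈ V → b ∈ V →
      IntervalIntegrable (fun t : ℝ => Ψ (a + t • (b - a)) * T (b - a)) volume 0 1 := by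
    intro a b ha hb
    refine ContinuousOn.intervalIntegrable ?_
    rw [uIcc_of_le zero_le_one]
    exact (hc.comp (by fun_prop) fun t ht => hV.add_smul_sub_mem ha hb ht).mul continuousOn_const
  have key := rectIntegral_unitSquare_eq_zero
    (P := fun p => ℓ (Ψ (x + p.1 • (u + p.2 • v)) * T (u + p.2 • v)))
    (Q := fun p => ℓ (Ψ (x + p.1 • (u + p.2 • v)) * (p.1 • T v)))
    (D := fun p => ℓ (T (p.1 • v) * d (x + p.1 • (u + p.2 • v)) * T (u + p.2 • v) +
      Ψ (x + p.1 • (u + p.2 • v)) * T v))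
    (ℓ.continuous.comp_continuousOn (hφc.mul (by fun_prop)))
    (ℓ.continuous.comp_continuousOn (hφc.mul (by fun_prop))) ?_ ?_ ?_ ?_
  · simp only [rectIntegral, zero_smul, one_smul, mul_zero, map_zero, add_zero,
      intervalIntegral.integral_zero, sub_zero] at key
    have hyz : ∀ t : ℝ, x + (u + t • v) = y + t • (z - y) := fun t => by
      rw [hu, hv]; abel
    have huv : u + v = z - x := by rw [hu, hv]; abel
    rw [map_sub, map_add]
    simp only [segIntegral]
    rw [← ContinuousLinearMap.intervalIntegral_comp_comm _ (hint x y hx hy),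
      ← ContinuousLinearMap.intervalIntegral_comp_comm _ (hint y z hy hz),
      ← ContinuousLinearMap.intervalIntegral_comp_comm _ (hint x z hx hz)]
    simpa only [hyz, huv] using key
  · rintro ⟨s, t⟩ ⟨hs, ht⟩
    exact (ℓ.hasFDerivAt.comp_hasDerivAt s ((hΨ.hasDerivAt x (u + t • v) s
      (hφ s (Ioo_subset_Icc_self hs) t (Ioo_subset_Icc_self ht))).mul_const
      (T (u + t • v)))).differentiableAt
  all_goals
    rintro ⟨s, t⟩ ⟨hs, ht⟩
    have hmem := hφ s (Ioo_subset_Icc_self hs) t (Ioo_subset_Icc_self ht)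
    have hsplit : ∀ t' : ℝ, x + s • (u + t' • v) = x + s • u + t' • (s • v) := fun t' => by
      rw [smul_add, smul_comm s t' v, add_assoc]
    have ht' : HasDerivAt (fun t' : ℝ => Ψ (x + s • (u + t' • v)))
        (T (s • v) * d (x + s • (u + t • v))) t := by
      have := hΨ.hasDerivAt (x + s • u) (s • v) t (by rwa [← hsplit])
      simpa only [hsplit] using this
  · have hT : HasDerivAt (fun t' : ℝ => T (u + t' • v)) (T v) t := by
      have h1 : HasDerivAt (fun t' : ℝ => u + t' • v) v t := by
        simpa using ((hasDerivAt_id t).smul_const v).const_add u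
      exact T.hasFDerivAt.comp_hasDerivAt t h1
    exact ℓ.hasFDerivAt.comp_hasDerivAt t (ht'.mul hT)
  · have h1 := hΨ.hasDerivAt x (u + t • v) s hmem
    have h2 : HasDerivAt (fun s' : ℝ => s' • T v) (T v) s := by
      simpa using (hasDerivAt_id s).smul_const (T v)
    have h3 := ℓ.hasFDerivAt.comp_hasDerivAt s (h1.mul h2)
    -- The two mixed partial derivatives agree because `A` is commutative.
    refine h3.congr_deriv ?_
    simp only [map_smul]
    congr 2
    simp only [smul_mul_assoc, mul_smul_comm]
    congr 1
    ring
  · exact (ℓ.hasFDerivAt.comp_hasDerivAt t (ht'.mul_const (s • T v))).differentiableAt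

theorem segIntegral_self (T : E →L[ℝ] A) (Ψ : E → A) (x : E) : segIntegral T Ψ x x = 0 := by
  simp [segIntegral]

theorem norm_segIntegral_sub_le {T : E →L[ℝ] A} {Ψ : E → A} {V : Set E} [CompleteSpace A]
    (hc : ContinuousOn Ψ V) (hV : Convex ℝ V) {x y : E} (hx : x ∈ V) (hy : y ∈ V) {c : A} {η : ℝ}
    (hη : ∀ w ∈ V, ‖Ψ w - c‖ ≤ η) :
    ‖segIntegral T Ψ x y - c * T (y - x)‖ ≤ η * ‖T (y - x)‖ := by
  have hint : IntervalIntegrable (fun t : ℝ => Ψ (x + t • (y - x)) * T (y - x)) volume 0 1 := by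
    refine ContinuousOn.intervalIntegrable ?_
    rw [uIcc_of_le zero_le_one]
    exact (hc.comp (by fun_prop) fun t ht => hV.add_smul_sub_mem hx hy ht).mul continuousOn_const
  have h1 : segIntegral T Ψ x y - c * T (y - x) =
      ∫ t in (0 : ℝ)..1, (Ψ (x + t • (y - x)) * T (y - x) - c * T (y - x)) := by
    rw [intervalIntegral.integral_sub hint intervalIntegrable_const]
    simp [segIntegral]
  rw [h1]
  refine (intervalIntegral.norm_integral_le_of_norm_le_const (C := η * ‖T (y - x)‖)
    fun t ht => ?_).trans (by simp)
  rw [uIoc_of_le zero_le_one] at ht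
  rw [← sub_mul]
  exact (norm_mul_le _ _).trans (mul_le_mul_of_nonneg_right
    (hη _ (hV.add_smul_sub_mem hx hy (Ioc_subset_Icc_self ht))) (norm_nonneg _))

end Segment

/-! ### Primitives, Stieltjes integrals and homotopy invariance -/

section Curves

variable {A E : Type*} [NormedCommRing A] [NormedAlgebra ℝ A] [CompleteSpace A]
  [NormedAddCommGroup E]

/-- A primitive of `Ψ dT` along a continuous map of a compact convex set. -/
theorem exists_primitive {X : Type*} [NormedSpace ℝ E] [NormedAddCommGroup X] [NormedSpace ℝ X]
    {T : E →L[ℝ] A} {U : Set E} {Ψ d : E → A} (hU : IsOpen U)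
    (hc : ContinuousOn Ψ U) (hΨ : HasDirectionalDerivOn T U Ψ d) {K : Set X} (hK : IsCompact K)
    (hKc : Convex ℝ K) (h0 : (0 : X) ∈ K) {H : X → E} (hH : ContinuousOn H K)
    (hHU : MapsTo H K U) :
    ∃ G : X → A, ∃ δ > 0, ∀ p ∈ K, ∀ q ∈ K, dist p q < δ →
      G q - G p = segIntegral T Ψ (H p) (H q) := by
  obtain ⟨r, hr, hrU⟩ := (hK.image_of_continuousOn hH).exists_thickening_subset_open hU
    hHU.image_subset
  obtain ⟨δ, hδ, hδH⟩ := Metric.uniformContinuousOn_iff.1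
    (hK.uniformContinuousOn_of_continuous hH) r hr
  obtain ⟨M, hM⟩ := hK.isBounded.exists_norm_le
  obtain ⟨m, hm⟩ := exists_nat_gt (M / (δ / 2))
  set n := m + 1 with hn
  have hn0 : (0 : ℝ) < n := by rw [hn]; positivity
  have hMn : ∀ p ∈ K, ‖p‖ / n < δ / 2 := by
    intro p hp
    rw [div_lt_iff₀ hn0]
    rw [div_lt_iff₀ (half_pos hδ)] at hm
    have : (m : ℝ) ≤ n := by rw [hn]; push_cast; linarith
    have := mul_le_mul_of_nonneg_right this (half_pos hδ).le
    linarith [hM p hp]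
  have hmem : ∀ p ∈ K, ∀ j ≤ n, ((j : ℝ) / n) • p ∈ K := by
    intro p hp j hj
    have h1 : (j : ℝ) ≤ n := by exact_mod_cast hj
    exact (hKc.starConvex h0).smul_mem hp (by positivity) ((div_le_one hn0).2 h1)
  -- `H` is merely continuous, so the image of the ray from `0` to `p` is replaced by an inscribed
  -- polygon. Radial steps and the displacement from `p` to `q` are each below `δ / 2`, which keeps
  -- the corners below within `δ` of one another's base point `a`.
  refine ⟨fun p => ∑ j ∈ Finset.range n,
    segIntegral T Ψ (H (((j : ℝ) / n) • p)) (H ((((j + 1 : ℕ) : ℝ) / n) • p)), δ / 2, half_pos hδ,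
    fun p hp q hq hpq => ?_⟩
  have hstep : ∀ j < n, ∀ p' : X, dist (((j : ℝ) / n) • p') ((((j + 1 : ℕ) : ℝ) / n) • p') =
      ‖p'‖ / n := by
    intro j hj p'
    rw [dist_eq_norm, ← sub_smul, norm_smul, ← sub_div]
    push_cast
    rw [sub_add_cancel_left, norm_div, norm_neg, norm_one, Real.norm_of_nonneg hn0.le]
    ring
  have hpar : ∀ j ≤ n, dist (((j : ℝ) / n) • p) (((j : ℝ) / n) • q) ≤ dist p q := by
    intro j hj
    have h1 : (j : ℝ) ≤ n := by exact_mod_cast hj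
    rw [dist_eq_norm, ← smul_sub, norm_smul, dist_eq_norm, Real.norm_of_nonneg (by positivity)]
    exact mul_le_of_le_one_left (norm_nonneg _) ((div_le_one hn0).2 h1)
  -- A quadrilateral between the two polygons lies in a ball inside `U`; cutting it along a diagonal
  -- gives two triangles. Summing over `j` then telescopes, the term at `j = 0` being a degenerate
  -- segment.
  have hsq : ∀ j ∈ Finset.range n,
      segIntegral T Ψ (H (((j : ℝ) / n) • q)) (H ((((j + 1 : ℕ) : ℝ) / n) • q)) -
      segIntegral T Ψ (H (((j : ℝ) / n) • p)) (H ((((j + 1 : ℕ) : ℝ) / n) • p)) =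
      segIntegral T Ψ (H ((((j + 1 : ℕ) : ℝ) / n) • p)) (H ((((j + 1 : ℕ) : ℝ) / n) • q)) -
      segIntegral T Ψ (H (((j : ℝ) / n) • p)) (H (((j : ℝ) / n) • q)) := by
    intro j hj
    rw [Finset.mem_range] at hj
    have ha := hmem p hp j hj.le
    have hb := hmem p hp (j + 1) hj
    have ha' := hmem q hq j hj.le
    have hb' := hmem q hq (j + 1) hj
    set a := ((j : ℝ) / n) • p
    set b := (((j + 1 : ℕ) : ℝ) / n) • p
    set a' := ((j : ℝ) / n) • q
    set b' := (((j + 1 : ℕ) : ℝ) / n) • q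
    have hball : ball (H a) r ⊆ U := fun w hw =>
      hrU (mem_thickening_iff.2 ⟨H a, mem_image_of_mem H ha, hw⟩)
    have d1 : dist b a < δ := by
      have := hstep j hj p
      rw [dist_comm]
      linarith [hMn p hp]
    have d2 : dist a' a < δ := by
      rw [dist_comm]
      linarith [hpar j hj.le]
    have d3 : dist b' a < δ := by
      have h1 := hstep j hj q
      have h2 := hpar j hj.le
      have h3 := dist_triangle a a' b'
      rw [dist_comm]
      linarith [hMn q hq]
    have mb : H b ∈ ball (H a) r := hδH b hb a ha d1
    have ma' : H a' ∈ ball (H a) r := hδH a' ha' a ha d2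
    have mb' : H b' ∈ ball (H a) r := hδH b' hb' a ha d3
    have ma : H a ∈ ball (H a) r := mem_ball_self hr
    have hΨ' : HasDirectionalDerivOn T (ball (H a) r) Ψ d := fun x hx => hΨ x (hball hx)
    have t1 := segIntegral_add (hc.mono hball) hΨ' (convex_ball _ _) ma mb mb'
    have t2 := segIntegral_add (hc.mono hball) hΨ' (convex_ball _ _) ma ma' mb'
    rw [sub_eq_sub_iff_add_eq_add, add_comm _ (segIntegral T Ψ (H a) (H a')),
      t2, add_comm, t1]
  rw [← Finset.sum_sub_distrib, Finset.sum_congr rfl hsq,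
    Finset.sum_range_sub fun j : ℕ =>
      segIntegral T Ψ (H (((j : ℝ) / n) • p)) (H (((j : ℝ) / n) • q))]
  simp [segIntegral_self]

/-- Tagged partition of `[0, 1]` of mesh less than `δ`, with `N` intervals. -/
def IsFinePartition (δ : ℝ) (N : ℕ) (t τ : ℕ → ℝ) : Prop :=
  t 0 = 0 ∧ t N = 1 ∧ ∀ i < N, t i ≤ τ i ∧ τ i ≤ t (i + 1) ∧ t (i + 1) - t i < δ

namespace IsFinePartition

variable {δ : ℝ} {N : ℕ} {t τ : ℕ → ℝ}

theorem mono {δ' : ℝ} (h : IsFinePartition δ N t τ) (hδ : δ ≤ δ') : IsFinePartition δ' N t τ :=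
  ⟨h.1, h.2.1, fun i hi => ⟨(h.2.2 i hi).1, (h.2.2 i hi).2.1, (h.2.2 i hi).2.2.trans_le hδ⟩⟩

theorem monotoneOn (h : IsFinePartition δ N t τ) : MonotoneOn t (Iic N) := by
  intro i _ j hj hij
  induction j, hij using Nat.le_induction with
  | base => exact le_rfl
  | succ j hij ih =>
    have hjN : j < N := hj
    have := h.2.2 j hjN
    exact (ih hjN.le).trans (this.1.trans this.2.1)

theorem mem_Icc (h : IsFinePartition δ N t τ) {i : ℕ} (hi : i ≤ N) : t i ∈ Icc (0 : ℝ) 1 := by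
  refine ⟨?_, ?_⟩
  · rw [← h.1]
    exact h.monotoneOn (Nat.zero_le N) hi (Nat.zero_le i)
  · rw [← h.2.1]
    exact h.monotoneOn hi (mem_Iic.2 le_rfl) hi

theorem tag_mem_Icc (h : IsFinePartition δ N t τ) {i : ℕ} (hi : i < N) : τ i ∈ Icc (0 : ℝ) 1 :=
  ⟨(h.mem_Icc hi.le).1.trans (h.2.2 i hi).1, (h.2.2 i hi).2.1.trans (h.mem_Icc hi).2⟩

theorem sum_norm_sub_le (h : IsFinePartition δ N t τ) {γ : ℝ → E}
    (hγ : BoundedVariationOn γ (Icc 0 1)) :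
    ∑ i ∈ Finset.range N, ‖γ (t (i + 1)) - γ (t i)‖ ≤ (eVariationOn γ (Icc 0 1)).toReal := by
  have h1 := eVariationOn.sum_le_of_monotoneOn_Iic (f := γ) (s := Icc (0 : ℝ) 1) h.monotoneOn
    (fun i hi => h.mem_Icc hi)
  simp only [edist_dist] at h1
  rw [← ENNReal.ofReal_sum_of_nonneg fun _ _ => dist_nonneg,
    ENNReal.ofReal_le_iff_le_toReal hγ] at h1
  simpa only [dist_eq_norm] using h1

end IsFinePartition

theorem exists_isFinePartition {δ : ℝ} (hδ : 0 < δ) : ∃ N t τ, IsFinePartition δ N t τ := by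
  obtain ⟨n, hn⟩ := exists_nat_one_div_lt hδ
  refine ⟨n + 1, fun i => (i : ℝ) / (n + 1), fun i => (i : ℝ) / (n + 1), by simp, ?_, fun i _ => ?_⟩
  · push_cast
    exact div_self (by positivity)
  · refine ⟨le_rfl, ?_, ?_⟩
    · push_cast
      gcongr
      linarith
    · push_cast
      rw [← sub_div, add_sub_cancel_left]
      exact hn

theorem eq_of_forall_dist_lt {B : Type*} {f : ℝ → B} {δ : ℝ} (hδ : 0 < δ)
    (hf : ∀ s ∈ Icc (0 : ℝ) 1, ∀ s' ∈ Icc (0 : ℝ) 1, dist s s' < δ → f s = f s') : f 0 = f 1 := by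
  obtain ⟨N, t, τ, ht⟩ := exists_isFinePartition hδ
  have : ∀ i ≤ N, f (t 0) = f (t i) := by
    intro i
    induction i with
    | zero => exact fun _ => rfl
    | succ i ih =>
      intro hi
      rw [ih (by omega)]
      have h1 := ht.2.2 i hi
      refine hf _ (ht.mem_Icc (by omega)) _ (ht.mem_Icc hi) ?_
      rw [dist_comm, Real.dist_eq, abs_of_nonneg (by linarith)]
      exact h1.2.2
  simpa only [ht.1, ht.2.1] using this N le_rfl

/-- The Riemann–Stieltjes sums of `Ψ dT` along `γ` tend to `I`. -/
def HasStieltjesIntegral [NormedSpace ℝ E] (T : E →L[ℝ] A) (γ : ℝ → E) (Ψ : E → A) (I : A) : Prop :=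
  ∀ η > 0, ∃ δ > 0, ∀ N t τ, IsFinePartition δ N t τ →
    ‖∑ i ∈ Finset.range N, Ψ (γ (τ i)) * T (γ (t (i + 1)) - γ (t i)) - I‖ < η

/-- The chord integrals telescope to the increment of `G`. By uniform continuity each differs from
its Stieltjes term by a small multiple of the chord length, and the chord lengths sum to at most the
variation. -/
theorem hasStieltjesIntegral_of_primitive [NormedSpace ℝ E] {T : E →L[ℝ] A}
    {U : Set E} {Ψ : E → A} (hU : IsOpen U)
    (hc : ContinuousOn Ψ U) {γ : ℝ → E} (hγ : ContinuousOn γ (Icc 0 1))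
    (hγU : MapsTo γ (Icc 0 1) U) (hγv : BoundedVariationOn γ (Icc 0 1)) {G : ℝ → A} {δ : ℝ}
    (hδ : 0 < δ) (hG : ∀ p ∈ Icc (0 : ℝ) 1, ∀ q ∈ Icc (0 : ℝ) 1, dist p q < δ →
      G q - G p = segIntegral T Ψ (γ p) (γ q)) :
    HasStieltjesIntegral T γ Ψ (G 1 - G 0) := by
  intro η hη
  set v := (eVariationOn γ (Icc 0 1)).toReal with hv
  have hv0 : 0 ≤ v := ENNReal.toReal_nonneg
  have hC : 0 < ‖T‖ * v + 1 := by positivity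
  set η' := η / (‖T‖ * v + 1) with hη'
  have hη'0 : 0 < η' := div_pos hη hC
  have hcomp : IsCompact (γ '' Icc 0 1) := isCompact_Icc.image_of_continuousOn hγ
  obtain ⟨r, hr, hrU⟩ := hcomp.exists_thickening_subset_open hU hγU.image_subset
  obtain ⟨ρ, hρ, hρΨ⟩ := Metric.mem_uniformity_dist.1 (hcomp.uniformContinuousAt_of_continuousAt Ψ
    (fun a ha => hc.continuousAt (hU.mem_nhds (hγU.image_subset ha)))
    (Metric.dist_mem_uniformity hη'0))
  obtain ⟨δ', hδ', hδγ⟩ := Metric.uniformContinuousOn_iff.1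
    (isCompact_Icc.uniformContinuousOn_of_continuous hγ) (min r ρ) (lt_min hr hρ)
  refine ⟨min δ δ', lt_min hδ hδ', fun N t τ ht => ?_⟩
  have htel : G 1 - G 0 = ∑ i ∈ Finset.range N, segIntegral T Ψ (γ (t i)) (γ (t (i + 1))) := by
    rw [← ht.1, ← ht.2.1, ← Finset.sum_range_sub fun i => G (t i)]
    refine Finset.sum_congr rfl fun i hi => ?_
    rw [Finset.mem_range] at hi
    refine hG _ (ht.mem_Icc hi.le) _ (ht.mem_Icc hi) ?_
    have h1 := ht.2.2 i hi
    have h2 := h1.2.2.trans_le (min_le_left _ _)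
    rw [dist_comm, Real.dist_eq, abs_of_nonneg (by linarith)]
    exact h2
  have hterm : ∀ i ∈ Finset.range N,
      ‖Ψ (γ (τ i)) * T (γ (t (i + 1)) - γ (t i)) - segIntegral T Ψ (γ (t i)) (γ (t (i + 1)))‖ ≤
        η' * (‖T‖ * ‖γ (t (i + 1)) - γ (t i)‖) := by
    intro i hi
    rw [Finset.mem_range] at hi
    obtain ⟨h1, h2, h3⟩ := ht.2.2 i hi
    have h3' := h3.trans_le (min_le_right _ _)
    have m0 := ht.tag_mem_Icc hi
    have m1 := hδγ _ (ht.mem_Icc hi.le) _ m0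
      (by rw [dist_comm, Real.dist_eq, abs_of_nonneg (by linarith)]; linarith)
    have m2 := hδγ _ (ht.mem_Icc hi) _ m0
      (by rw [Real.dist_eq, abs_of_nonneg (by linarith)]; linarith)
    have hball : ball (γ (τ i)) (min r ρ) ⊆ U := fun w hw =>
      hrU (mem_thickening_iff.2 ⟨_, mem_image_of_mem γ m0, lt_of_lt_of_le hw (min_le_left _ _)⟩)
    rw [norm_sub_rev]
    refine (norm_segIntegral_sub_le (V := ball (γ (τ i)) (min r ρ)) (hc.mono hball)
      (convex_ball _ _) m1 m2 (η := η') fun w hw => ?_).trans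
      (mul_le_mul_of_nonneg_left (T.le_opNorm _) hη'0.le)
    have h4 : dist (γ (τ i)) w < ρ := by
      rw [dist_comm]
      exact lt_of_lt_of_le hw (min_le_right _ _)
    have h5 := hρΨ h4 (mem_image_of_mem γ m0)
    rw [← dist_eq_norm, dist_comm]
    exact le_of_lt h5
  rw [htel, ← Finset.sum_sub_distrib]
  calc _ ≤ ∑ i ∈ Finset.range N, η' * (‖T‖ * ‖γ (t (i + 1)) - γ (t i)‖) := norm_sum_le_of_le _ hterm
    _ = η' * (‖T‖ * ∑ i ∈ Finset.range N, ‖γ (t (i + 1)) - γ (t i)‖) := by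
        rw [Finset.mul_sum, Finset.mul_sum]
    _ ≤ η' * (‖T‖ * v) := by
        gcongr
        exact ht.sum_norm_sub_le hγv
    _ < η' * (‖T‖ * v + 1) := by
        gcongr
        linarith
    _ = η := div_mul_cancel₀ _ hC.ne'

/-- The integral of `Ψ dT` is invariant under homotopies of closed rectifiable curves. -/
theorem exists_hasStieltjesIntegral_of_homotopic {k : ℕ} {T : Coord k →L[ℝ] A}
    {U : Set (Coord k)} {Ψ d : Coord k → A} (hU : IsOpen U) (hc : ContinuousOn Ψ U)
    (hΨ : HasDirectionalDerivOn T U Ψ d) {γ₀ γ₁ : ℝ → Coord k}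
    (hγ₀ : BoundedVariationOn γ₀ (Icc 0 1)) (hγ₁ : BoundedVariationOn γ₁ (Icc 0 1))
    (hhom : ClosedHomotopicIn U γ₀ γ₁) :
    ∃ I, HasStieltjesIntegral T γ₀ Ψ I ∧ HasStieltjesIntegral T γ₁ Ψ I := by
  obtain ⟨H, hH, hHU, h0, h1, hcl⟩ := hhom
  obtain ⟨G, δ, hδ, hG⟩ := exists_primitive hU hc hΨ
    (isCompact_Icc.prod isCompact_Icc : IsCompact (Icc (0 : ℝ) 1 ×ˢ Icc (0 : ℝ) 1))
    ((convex_Icc _ _).prod (convex_Icc _ _)) ⟨by simp, by simp⟩ hH hHU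
  have hend : ∀ s ∈ Icc (0 : ℝ) 1, ∀ γ : ℝ → Coord k, (∀ t ∈ Icc (0 : ℝ) 1, H (s, t) = γ t) →
      BoundedVariationOn γ (Icc 0 1) → HasStieltjesIntegral T γ Ψ (G (s, 1) - G (s, 0)) := by
    intro s hs γ hHγ hγ
    refine hasStieltjesIntegral_of_primitive (G := fun t => G (s, t)) hU hc ?_ ?_ hγ hδ
      fun p hp q hq hpq => ?_
    · exact (hH.comp (by fun_prop) fun t ht => ⟨hs, ht⟩ :
        ContinuousOn (fun t => H (s, t)) (Icc 0 1)).congr fun t ht => (hHγ t ht).symm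
    · intro t ht
      rw [← hHγ t ht]
      exact hHU ⟨hs, ht⟩
    · rw [← hHγ p hp, ← hHγ q hq]
      refine hG _ ⟨hs, hp⟩ _ ⟨hs, hq⟩ ?_
      simpa [Prod.dist_eq, hδ] using hpq
  have hz : (0 : ℝ) ∈ Icc (0 : ℝ) 1 := by simp
  have ho : (1 : ℝ) ∈ Icc (0 : ℝ) 1 := by simp
  refine ⟨G (0, 1) - G (0, 0), hend 0 hz γ₀ h0 hγ₀, ?_⟩
  -- The curves `t ↦ H (s, t)` are closed, so for nearby `s` the increments of `G` along `t = 0` and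
  -- `t = 1` are the same segment integral and the difference is locally constant.
  have hconst : G (0, 1) - G (0, 0) = G (1, 1) - G (1, 0) := by
    refine eq_of_forall_dist_lt (f := fun s => G (s, 1) - G (s, 0)) hδ fun s hs s' hs' hss => ?_
    have e0 := hG (s, 0) ⟨hs, hz⟩ (s', 0) ⟨hs', hz⟩ (by simpa [Prod.dist_eq, hδ] using hss)
    have e1 := hG (s, 1) ⟨hs, ho⟩ (s', 1) ⟨hs', ho⟩ (by simpa [Prod.dist_eq, hδ] using hss)
    rw [← hcl s hs, ← hcl s' hs', ← e0] at e1
    rw [sub_eq_sub_iff_add_eq_add] at e1 ⊢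
    rw [add_comm, ← e1, add_comm]
  rw [hconst]
  exact hend 1 ho γ₁ h1 hγ₁

end Curves

theorem HasStieltjesIntegral.unique {A E : Type*} [NormedCommRing A] [NormedAlgebra ℝ A]
    [NormedAddCommGroup E] [NormedSpace ℝ E] {T : E →L[ℝ] A} {γ : ℝ → E} {Ψ : E → A} {I J : A}
    (hI : HasStieltjesIntegral T γ Ψ I) (hJ : HasStieltjesIntegral T γ Ψ J) : I = J := by
  refine eq_of_forall_dist_le fun η hη => ?_
  obtain ⟨δ, hδ, h⟩ := hI (η / 2) (half_pos hη)
  obtain ⟨δ', hδ', h'⟩ := hJ (η / 2) (half_pos hη)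
  obtain ⟨N, t, τ, ht⟩ := exists_isFinePartition (lt_min hδ hδ')
  have h1 := h N t τ (ht.mono (min_le_left _ _))
  have h2 := h' N t τ (ht.mono (min_le_right _ _))
  rw [← dist_eq_norm] at h1 h2
  have h3 := dist_triangle_left I J
    (∑ i ∈ Finset.range N, Ψ (γ (τ i)) * T (γ (t (i + 1)) - γ (t i)))
  linarith

/-! ### Circles in a plane -/

section Plane

variable {k : ℕ}

/-- The point of the unit circle of the plane `span {a, b}` with the angle `θ`. -/
noncomputable def direction (a b : Coord k) (θ : ℝ) : Coord k :=
  Real.cos θ • a + Real.sin θ • b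

theorem circle_eq (x₀ a b : Coord k) (ε t : ℝ) :
    circle x₀ a b ε t = x₀ + ε • direction a b (2 * Real.pi * t) := rfl

theorem norm_direction {a b : Coord k} (h : Orthonormal ℝ ![a, b]) (θ : ℝ) :
    ‖direction a b θ‖ = 1 := by
  have ha : ‖a‖ = 1 := by simpa using h.1 0
  have hb : ‖b‖ = 1 := by simpa using h.1 1
  have hab : inner ℝ a b = 0 := by simpa using h.2 (i := 0) (j := 1) (by simp)
  have h2 : ‖direction a b θ‖ ^ 2 = 1 := by
    rw [direction, norm_add_sq_real, norm_smul, norm_smul, inner_smul_left, inner_smul_right, ha,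
      hb, hab]
    simp [sq_abs]
  have h3 := norm_nonneg (direction a b θ)
  nlinarith

theorem direction_mem_span (a b : Coord k) (θ : ℝ) :
    direction a b θ ∈ Submodule.span ℝ {a, b} :=
  add_mem (Submodule.smul_mem _ _ (Submodule.subset_span (by simp)))
    (Submodule.smul_mem _ _ (Submodule.subset_span (by simp)))

theorem contDiff_circle (x₀ a b : Coord k) (ε : ℝ) : ContDiff ℝ 1 (circle x₀ a b ε) := by
  unfold circle
  fun_prop

theorem boundedVariationOn_circle (x₀ a b : Coord k) (ε : ℝ) :
    BoundedVariationOn (circle x₀ a b ε) (Icc 0 1) := by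
  rw [← uIcc_of_le zero_le_one]
  exact (contDiff_circle x₀ a b ε).contDiffOn.absolutelyContinuousOnInterval.boundedVariationOn

theorem closedHomotopicIn_circle {U : Set (Coord k)} {x₀ a b : Coord k} {r₀ r₁ : ℝ}
    (h : ∀ s ∈ Icc (0 : ℝ) 1, ∀ θ, x₀ + ((1 - s) * r₀ + s * r₁) • direction a b θ ∈ U) :
    ClosedHomotopicIn U (circle x₀ a b r₀) (circle x₀ a b r₁) := by
  refine ⟨fun p => circle x₀ a b ((1 - p.1) * r₀ + p.1 * r₁) p.2, ?_, fun p hp => h _ hp.1 _, ?_,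
    ?_, ?_⟩
  · unfold circle
    fun_prop
  · intro t _
    simp
  · intro t _
    simp
  · intro s _
    simp [circle]

end Plane

/-! ### Invertible elements and the Cauchy kernel -/

section Algebra

variable {A : Type*} [NormedCommRing A] [NormedAlgebra ℂ A] {k : ℕ}

/-- The map `x ↦ ∑ x_j e_j` as a continuous linear map. -/
noncomputable def pointL (e : Fin k → A) : Coord k →L[ℝ] A :=
  LinearMap.toContinuousLinearMap
    { toFun := point e
      map_add' := fun x y => by simp [point, add_smul, Finset.sum_add_distrib]
      map_smul' := fun c x => by simp [point, mul_smul, Finset.smul_sum] }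

theorem pointL_apply (e : Fin k → A) (x : Coord k) : pointL e x = point e x := rfl

theorem HasStieltjesIntegral.hasCurveIntegral {e : Fin k → A} {γ : ℝ → Coord k} {Ψ : Coord k → A}
    {I : A} (h : HasStieltjesIntegral (pointL e) γ Ψ I) : HasCurveIntegral e γ Ψ I := by
  intro U hU
  obtain ⟨η, hη, hηU⟩ := Metric.mem_nhds_iff.1 hU
  obtain ⟨δ, hδ, hS⟩ := h η hη
  refine ⟨δ, hδ, fun N t τ h0 h1 ht => hηU ?_⟩
  have := hS N t τ ⟨h0, h1, ht⟩
  simp only [map_sub, pointL_apply] at this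
  rwa [mem_ball, dist_eq_norm]

/-- The left-hand limit in direction `h` is minus the right-hand limit in direction `-h`, and the
derivative is linear in `h`. -/
theorem Monogenic.exists_hasDirectionalDerivOn {e : Fin k → A} {Ω : Set (Coord k)}
    {Φ : Coord k → A} (h : Monogenic e Ω Φ) : ∃ d, HasDirectionalDerivOn (pointL e) Ω Φ d := by
  have h2 := h.2
  choose! d hd using h2
  refine ⟨d, fun x hx v => ?_⟩
  rw [hasDerivAt_iff_tendsto_slope_zero, ← Iio_union_Ioi, nhdsWithin_union, tendsto_sup]
  simp only [zero_add, zero_smul, add_zero]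
  refine ⟨?_, hd x hx v⟩
  have hneg : Tendsto (fun t : ℝ => -t) (𝓝[<] 0) (𝓝[>] 0) := by
    simpa using tendsto_neg_nhdsLT (a := (0 : ℝ))
  have h3 := ((hd x hx (-v)).comp hneg).neg
  have h4 : -(point e (-v) * d x) = pointL e v * d x := by
    rw [← pointL_apply, map_neg, neg_mul, neg_neg]
  rw [h4] at h3
  refine h3.congr fun t => ?_
  simp [inv_neg]

theorem inverse_smul {a : A} (ha : IsUnit a) {c : ℝ} (hc : c ≠ 0) :
    Ring.inverse (c • a) = c⁻¹ • Ring.inverse a := by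
  have h1 : (c • a) * (c⁻¹ • Ring.inverse a) = 1 := by
    rw [smul_mul_smul_comm, mul_inv_cancel₀ hc, Ring.mul_inverse_cancel _ ha, one_smul]
  have h2 : IsUnit (c • a) := IsUnit.of_mul_eq_one _ h1
  calc Ring.inverse (c • a) = Ring.inverse (c • a) * ((c • a) * (c⁻¹ • Ring.inverse a)) := by
        rw [h1, mul_one]
    _ = c⁻¹ • Ring.inverse a := by rw [← mul_assoc, Ring.inverse_mul_cancel _ h2, one_mul]

variable [CompleteSpace A]

/-- A non-unit lies in a maximal ideal, and in a commutative complex Banach algebra this is the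
kernel of a character. -/
theorem isUnit_of_forall_algHom_ne_zero {a : A} (h : ∀ f : A →ₐ[ℂ] ℂ, f a ≠ 0) : IsUnit a := by
  by_contra ha
  obtain ⟨f, hf⟩ := WeakDual.CharacterSpace.exists_apply_eq_zero ha
  exact h (WeakDual.CharacterSpace.toAlgHom f) hf

/-- The points of `Ω` whose difference with `x₀` is invertible in the algebra. -/
def regularSet (e : Fin k → A) (Ω : Set (Coord k)) (x₀ : Coord k) : Set (Coord k) :=
  {x ∈ Ω | IsUnit (point e x - point e x₀)}

theorem isOpen_regularSet (e : Fin k → A) {Ω : Set (Coord k)} (hΩ : IsOpen Ω) (x₀ : Coord k) :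
    IsOpen (regularSet e Ω x₀) :=
  hΩ.inter (Units.isOpen.preimage
    (((pointL e).continuous.sub continuous_const : Continuous fun x => pointL e x - point e x₀)))

theorem sdiff_singularSet_subset (e : Fin k → A) (Ω : Set (Coord k)) (x₀ : Coord k) :
    Ω \ singularSet e x₀ ⊆ regularSet e Ω x₀ := fun _ hx =>
  ⟨hx.1, isUnit_of_forall_algHom_ne_zero fun f hf => hx.2 ⟨f, hf⟩⟩

/-- Inversion is Fréchet differentiable at units, so the product rule holds along lines;
commutativity brings the result to the form `T h * _`. -/
theorem hasDirectionalDerivOn_mul_inverse {e : Fin k → A} {Ω : Set (Coord k)} {Φ d : Coord k → A}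
    (hΦ : HasDirectionalDerivOn (pointL e) Ω Φ d) (x₀ : Coord k) :
    HasDirectionalDerivOn (pointL e) (regularSet e Ω x₀)
      (fun x => Φ x * Ring.inverse (point e x - point e x₀))
      (fun x => d x * Ring.inverse (point e x - point e x₀) -
        Φ x * Ring.inverse (point e x - point e x₀) ^ 2) := by
  rintro x ⟨hxΩ, u, hu⟩ h
  have h1 : HasDerivAt (fun s : ℝ => point e (x + s • h) - point e x₀) (pointL e h) 0 := by
    have : HasDerivAt (fun s : ℝ => pointL e x + s • pointL e h - point e x₀) (pointL e h) 0 := by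
      simpa using (((hasDerivAt_id (0 : ℝ)).smul_const (pointL e h)).const_add
        (pointL e x)).sub_const (point e x₀)
    refine this.congr_of_eventuallyEq (Eventually.of_forall fun s => ?_)
    simp only [← pointL_apply, map_add, map_smul]
  have h2 : HasFDerivAt Ring.inverse (-((ContinuousLinearMap.mulLeftRight ℝ A) ↑u⁻¹) ↑u⁻¹)
      (point e (x + (0 : ℝ) • h) - point e x₀) := by
    rw [zero_smul, add_zero, ← hu]
    exact hasFDerivAt_ringInverse u
  have h3 := (hΦ x hxΩ h).mul (h2.comp_hasDerivAt (0 : ℝ) h1)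
  refine h3.congr_deriv ?_
  simp only [Function.comp_apply, zero_smul, add_zero, ← hu, Ring.inverse_unit,
    neg_apply, ContinuousLinearMap.mulLeftRight_apply]
  ring

theorem continuousOn_mul_inverse {e : Fin k → A} {Ω : Set (Coord k)} {Φ : Coord k → A}
    (hΦ : ContinuousOn Φ Ω) (x₀ : Coord k) :
    ContinuousOn (fun x => Φ x * Ring.inverse (point e x - point e x₀)) (regularSet e Ω x₀) := by
  refine (hΦ.mono fun x hx => hx.1).mul fun x hx => ContinuousAt.continuousWithinAt ?_
  obtain ⟨u, hu⟩ := hx.2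
  refine ContinuousAt.comp (f := fun x => point e x - point e x₀) (g := Ring.inverse) ?_
    ((pointL e).continuous.sub continuous_const).continuousAt
  rw [← hu]
  exact NormedRing.inverse_continuousAt u

end Algebra

/-! ### Embracing circles and the Cauchy formula -/

/-- The boundary of a bounded open set is not contained in a real line through a point of the
set. -/
theorem not_frontier_subset_line {D : Set ℂ} (hD : IsOpen D) (hb : Bornology.IsBounded D) {p : ℂ}
    (hp : p ∈ D) (w : ℂ) : ¬ frontier D ⊆ range fun r : ℝ => p + r • w := by
  intro hsub
  -- Along a direction `v` transverse to the line, the bounded set must be left, so a frontier point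
  -- occurs off the line unless it is `p` itself, which is interior.
  obtain ⟨v, hv0, hv⟩ : ∃ v : ℂ, v ≠ 0 ∧ ∀ r s : ℝ, s • v = r • w → s = 0 := by
    by_cases hw : w = 0
    · exact ⟨1, one_ne_zero, fun r s h => by simpa [hw] using h⟩
    · refine ⟨Complex.I * w, mul_ne_zero Complex.I_ne_zero hw, fun r s h => ?_⟩
      have h1 : ((s : ℂ) * Complex.I) * w = (r : ℂ) * w := by
        simpa [mul_assoc] using h
      have h2 := congrArg Complex.im (mul_right_cancel₀ hw h1)
      simpa using h2
  have hcont : Continuous fun s : ℝ => p + s • v := by fun_prop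
  have hVo : IsOpen ((fun s : ℝ => p + s • v) ⁻¹' D) := hD.preimage hcont
  have hne : ((fun s : ℝ => p + s • v) ⁻¹' D) ≠ univ := by
    intro huniv
    obtain ⟨M, hM⟩ := hb.exists_norm_le
    have h1 := hM _ (eq_univ_iff_forall.1 huniv ((‖p‖ + |M| + 1) / ‖v‖))
    have h2 : ‖((‖p‖ + |M| + 1) / ‖v‖) • v‖ = ‖p‖ + |M| + 1 := by
      rw [norm_smul, Real.norm_of_nonneg (by positivity),
        div_mul_cancel₀ _ (norm_ne_zero_iff.2 hv0)]
    have h3 := norm_sub_le (p + ((‖p‖ + |M| + 1) / ‖v‖) • v) p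
    rw [add_sub_cancel_left, h2] at h3
    linarith [le_abs_self M]
  obtain ⟨s, hs⟩ := nonempty_frontier_iff.2 ⟨⟨0, by simpa using hp⟩, hne⟩
  obtain ⟨r, hr⟩ := hsub (hcont.frontier_preimage_subset D hs)
  have hs0 : s = 0 := hv r s (add_left_cancel hr).symm
  have hmem : s ∈ (fun s : ℝ => p + s • v) ⁻¹' D := by
    simpa [hs0] using hp
  exact (hVo.inter_frontier_eq.subset ⟨hmem, hs⟩ : s ∈ (∅ : Set ℝ))

section

variable {A : Type*} [NormedCommRing A] [NormedAlgebra ℂ A] {k : ℕ} {e : Fin k → A}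
  {Ω : Set (Coord k)} {x₀ a b : Coord k} {ε : ℝ}

/-- If `f` kills one direction of the plane, its values on the plane's directions are real multiples
of the value `w` at the orthogonal direction, so the image of the circle lies on a line through
`f(ζ₀)`. -/
theorem IsEmbracingCircle.algHom_direction_ne_zero (hC : IsEmbracingCircle e Ω x₀ a b ε)
    (f : A →ₐ[ℂ] ℂ) (θ : ℝ) : f (point e (direction a b θ)) ≠ 0 := by
  intro h0
  obtain ⟨D, hDo, -, hDb, hfr, hx⟩ := hC.embraces f
  have hlin : ∀ φ, f (point e (direction a b φ)) =
      Real.cos φ * f (point e a) + Real.sin φ * f (point e b) := by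
    intro φ
    have hsm : ∀ (c : ℝ) (z : A), f (c • z) = c * f z := fun c z => by
      rw [← Complex.coe_smul, map_smul, smul_eq_mul]
    rw [← pointL_apply, direction, map_add, map_smul, map_smul, map_add, hsm, hsm]
    rfl
  rw [hlin] at h0
  set α := f (point e a)
  set β := f (point e b)
  set w : ℂ := -Real.sin θ * α + Real.cos θ * β with hw
  have hsc : ((Real.sin θ : ℝ) : ℂ) ^ 2 + ((Real.cos θ : ℝ) : ℂ) ^ 2 = 1 := by
    exact_mod_cast Real.sin_sq_add_cos_sq θ
  have hα : α = -Real.sin θ * w := by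
    linear_combination (-α) * hsc + (Real.cos θ : ℂ) * h0
  have hβ : β = Real.cos θ * w := by
    linear_combination (-β) * hsc + (Real.sin θ : ℂ) * h0
  refine not_frontier_subset_line hDo hDb hx w ?_
  rw [hfr]
  rintro _ ⟨t, -, rfl⟩
  refine ⟨ε * (Real.sin (2 * Real.pi * t) * Real.cos θ -
    Real.cos (2 * Real.pi * t) * Real.sin θ), ?_⟩
  have h1 : point e (circle x₀ a b ε t) =
      point e x₀ + (ε : ℂ) • point e (direction a b (2 * Real.pi * t)) := by
    rw [circle_eq, ← pointL_apply, map_add, map_smul, Complex.coe_smul]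
    rfl
  simp only
  rw [h1, map_add, map_smul, hlin, smul_eq_mul, Complex.real_smul]
  push_cast
  rw [Complex.ofReal_sin] at hα
  rw [Complex.ofReal_cos] at hβ
  linear_combination (-(ε : ℂ) * Complex.cos (2 * Real.pi * t)) * hα -
    ((ε : ℂ) * Complex.sin (2 * Real.pi * t)) * hβ

theorem isUnit_smul {c : ℝ} (hc : c ≠ 0) {z : A} (hz : IsUnit z) : IsUnit (c • z) := by
  obtain ⟨u, rfl⟩ := hz
  exact ((Units.mk0 c hc) • u).isUnit

variable [CompleteSpace A]

theorem IsEmbracingCircle.isUnit_direction (hC : IsEmbracingCircle e Ω x₀ a b ε) (θ : ℝ) :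
    IsUnit (point e (direction a b θ)) :=
  isUnit_of_forall_algHom_ne_zero fun f => hC.algHom_direction_ne_zero f θ

/-- This permits shrinking the circle to any positive radius inside the region where the kernel is
defined. -/
theorem IsEmbracingCircle.mem_regularSet (hC : IsEmbracingCircle e Ω x₀ a b ε) {r : ℝ}
    (hr : 0 < r) (hrε : r ≤ ε) (θ : ℝ) : x₀ + r • direction a b θ ∈ regularSet e Ω x₀ := by
  refine ⟨hC.disc_subset ⟨?_, ?_⟩, ?_⟩
  · rw [add_sub_cancel_left]
    exact Submodule.smul_mem _ _ (direction_mem_span a b θ)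
  · rw [add_sub_cancel_left, norm_smul, norm_direction hC.orthonormal, mul_one,
      Real.norm_of_nonneg hr.le]
    exact hrε
  · rw [← pointL_apply, map_add, map_smul, pointL_apply, pointL_apply, add_sub_cancel_left]
    exact isUnit_smul hr.ne' (hC.isUnit_direction θ)

theorem IsEmbracingCircle.exists_integral_inverse (hC : IsEmbracingCircle e Ω x₀ a b ε) :
    ∃ lam, HasStieltjesIntegral (pointL e) (circle 0 a b ε)
      (fun x => Ring.inverse (point e x)) lam := by
  have h1 : HasDirectionalDerivOn (pointL e) univ (fun _ => (1 : A)) fun _ => 0 := by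
    intro x _ h
    simpa using hasDerivAt_const (0 : ℝ) (1 : A)
  have hz : point e (0 : Coord k) = 0 := by rw [← pointL_apply, map_zero]
  -- A constant homotopy suffices, as only existence is wanted.
  obtain ⟨lam, hlam, -⟩ := exists_hasStieltjesIntegral_of_homotopic
    (isOpen_regularSet e isOpen_univ 0) (continuousOn_mul_inverse continuousOn_const 0)
    (hasDirectionalDerivOn_mul_inverse h1 0)
    (boundedVariationOn_circle 0 a b ε) (boundedVariationOn_circle 0 a b ε)
    (closedHomotopicIn_circle fun s _ θ => by
      refine ⟨mem_univ _, ?_⟩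
      rw [show (1 - s) * ε + s * ε = ε by ring, zero_add, hz, sub_zero, ← pointL_apply, map_smul]
      exact isUnit_smul hC.radius_pos.ne' (hC.isUnit_direction θ))
  exact ⟨lam, by simpa only [one_mul, hz, sub_zero] using hlam⟩

/-- Passage to the limit in the integrals along the circles of radius `r → 0`. -/
theorem IsEmbracingCircle.integral_eq (hC : IsEmbracingCircle e Ω x₀ a b ε) {Φ : Coord k → A}
    (hΦ : ContinuousAt Φ x₀) {lam I : A}
    (hlam : HasStieltjesIntegral (pointL e) (circle 0 a b ε)
      (fun x => Ring.inverse (point e x)) lam)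
    (hI : ∀ r, 0 < r → r ≤ ε → HasStieltjesIntegral (pointL e) (circle x₀ a b r)
      (fun x => Φ x * Ring.inverse (point e x - point e x₀)) I) :
    I = lam * Φ x₀ := by
  have hε := hC.radius_pos
  have hinv : ContinuousOn (fun t => Ring.inverse (point e (circle 0 a b ε t))) (Icc 0 1) := by
    refine Continuous.continuousOn (continuous_iff_continuousAt.2 fun t => ?_)
    refine ContinuousAt.comp (f := fun t => point e (circle 0 a b ε t)) (g := Ring.inverse) ?_
      ((pointL e).continuous.comp (contDiff_circle 0 a b ε).continuous).continuousAt
    have hu : IsUnit (point e (circle 0 a b ε t)) := by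
      rw [circle_eq, zero_add, ← pointL_apply, map_smul]
      exact isUnit_smul hε.ne' (hC.isUnit_direction _)
    obtain ⟨u, hu⟩ := hu
    rw [← hu]
    exact NormedRing.inverse_continuousAt u
  obtain ⟨M, hM⟩ := isCompact_Icc.exists_bound_of_continuousOn hinv
  have hM0 : 0 ≤ M := (norm_nonneg _).trans (hM 0 (by simp))
  set v := (eVariationOn (circle 0 a b ε) (Icc 0 1)).toReal with hv
  have hv0 : 0 ≤ v := ENNReal.toReal_nonneg
  -- The three summands match three errors of relative size `κ`: the Stieltjes sum for `I`,
  -- replacing `Φ` by `Φ x₀`, and the Stieltjes sum for `lam`.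
  set B := 1 + M * ‖pointL e‖ * v + ‖Φ x₀‖ with hB
  have hB0 : 0 < B := by positivity
  refine eq_of_forall_dist_le fun η hη => ?_
  set κ := η / B with hκ
  have hκ0 : 0 < κ := div_pos hη hB0
  obtain ⟨ρ, hρ, hΦρ⟩ := Metric.continuousAt_iff.1 hΦ κ hκ0
  set r := min (ρ / 2) ε with hr
  have hr0 : 0 < r := lt_min (half_pos hρ) hε
  have hrρ : r < ρ := (min_le_left _ _).trans_lt (half_lt_self hρ)
  obtain ⟨δ₁, hδ₁, h₁⟩ := hI r hr0 (min_le_right _ _) κ hκ0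
  obtain ⟨δ₂, hδ₂, h₂⟩ := hlam κ hκ0
  obtain ⟨N, t, τ, ht⟩ := exists_isFinePartition (lt_min hδ₁ hδ₂)
  have h₁' := h₁ N t τ (ht.mono (min_le_left _ _))
  have h₂' := h₂ N t τ (ht.mono (min_le_right _ _))
  set q : ℕ → A := fun i => Ring.inverse (point e (circle 0 a b ε (τ i))) *
    pointL e (circle 0 a b ε (t (i + 1)) - circle 0 a b ε (t i)) with hq
  have hscale : ∀ s, circle x₀ a b r s = x₀ + (r / ε) • circle 0 a b ε s := fun s => by
    rw [circle_eq, circle_eq, zero_add, smul_smul, div_mul_cancel₀ _ hε.ne']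
  -- The factor `r / ε` of the increment cancels against the one in the inverse, so `q` does not
  -- depend on `r`.
  have hterm : ∀ i, Φ (circle x₀ a b r (τ i)) *
      Ring.inverse (point e (circle x₀ a b r (τ i)) - point e x₀) *
      pointL e (circle x₀ a b r (t (i + 1)) - circle x₀ a b r (t i)) =
      Φ (circle x₀ a b r (τ i)) * q i := by
    intro i
    have hc : r / ε ≠ 0 := (div_pos hr0 hε).ne'
    have hu : IsUnit (pointL e (circle 0 a b ε (τ i))) := by
      rw [circle_eq, zero_add, map_smul]
      exact isUnit_smul hε.ne' (hC.isUnit_direction _)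
    have e1 : point e (circle x₀ a b r (τ i)) - point e x₀ =
        (r / ε) • pointL e (circle 0 a b ε (τ i)) := by
      rw [hscale, ← pointL_apply, ← pointL_apply, map_add, map_smul, add_sub_cancel_left]
    have e2 : circle x₀ a b r (t (i + 1)) - circle x₀ a b r (t i) =
        (r / ε) • (circle 0 a b ε (t (i + 1)) - circle 0 a b ε (t i)) := by
      rw [hscale, hscale, add_sub_add_left_eq_sub, smul_sub]
    rw [e1, e2, map_smul, inverse_smul hu hc, mul_assoc, smul_mul_smul_comm, inv_mul_cancel₀ hc,
      one_smul]
    rfl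
  have hsumq : ∑ i ∈ Finset.range N, ‖q i‖ ≤ M * ‖pointL e‖ * v := by
    calc ∑ i ∈ Finset.range N, ‖q i‖ ≤ ∑ i ∈ Finset.range N,
          M * (‖pointL e‖ * ‖circle 0 a b ε (t (i + 1)) - circle 0 a b ε (t i)‖) := by
          refine Finset.sum_le_sum fun i hi => (norm_mul_le _ _).trans ?_
          exact mul_le_mul (hM _ (ht.tag_mem_Icc (Finset.mem_range.1 hi)))
            ((pointL e).le_opNorm _) (norm_nonneg _) hM0
      _ = M * ‖pointL e‖ *
          ∑ i ∈ Finset.range N, ‖circle 0 a b ε (t (i + 1)) - circle 0 a b ε (t i)‖ := by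
          rw [Finset.mul_sum]
          simp only [mul_assoc]
      _ ≤ M * ‖pointL e‖ * v := by
          gcongr
          exact ht.sum_norm_sub_le (boundedVariationOn_circle 0 a b ε)
  have hdiff : ‖∑ i ∈ Finset.range N, Φ (circle x₀ a b r (τ i)) * q i -
      (∑ i ∈ Finset.range N, q i) * Φ x₀‖ ≤ κ * (M * ‖pointL e‖ * v) := by
    rw [Finset.sum_mul, ← Finset.sum_sub_distrib]
    calc _ ≤ ∑ i ∈ Finset.range N, κ * ‖q i‖ := by
          refine norm_sum_le_of_le _ fun i _ => ?_
          rw [mul_comm (q i), ← sub_mul]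
          refine (norm_mul_le _ _).trans (mul_le_mul_of_nonneg_right ?_ (norm_nonneg _))
          rw [← dist_eq_norm]
          refine (hΦρ ?_).le
          rw [circle_eq, dist_eq_norm, add_sub_cancel_left, norm_smul,
            norm_direction hC.orthonormal, mul_one, Real.norm_of_nonneg hr0.le]
          exact hrρ
      _ ≤ κ * (M * ‖pointL e‖ * v) := by
          rw [← Finset.mul_sum]
          exact mul_le_mul_of_nonneg_left hsumq hκ0.le
  simp only [hterm] at h₁'
  have hlast : ‖(∑ i ∈ Finset.range N, q i) * Φ x₀ - lam * Φ x₀‖ ≤ κ * ‖Φ x₀‖ := by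
    rw [← sub_mul]
    exact (norm_mul_le _ _).trans (mul_le_mul_of_nonneg_right h₂'.le (norm_nonneg _))
  rw [← dist_eq_norm] at h₁' hdiff hlast
  calc dist I (lam * Φ x₀) ≤ κ + κ * (M * ‖pointL e‖ * v) + κ * ‖Φ x₀‖ := by
        rw [dist_comm] at h₁'
        refine (dist_triangle4 _ _ _ _).trans (add_le_add (add_le_add h₁'.le hdiff) hlast)
    _ = κ * B := by rw [hB]; ring
    _ = η := div_mul_cancel₀ _ hB0.ne'

/-- The Cauchy formula for a normed algebra. -/
theorem exists_hasCurveIntegral (hΩ : IsOpen Ω) {Φ : Coord k → A} (hΦ : Monogenic e Ω Φ)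
    (hx₀ : x₀ ∈ Ω) {γ : ℝ → Coord k} (hγ : BoundedVariationOn γ (Icc 0 1))
    (hC : IsEmbracingCircle e Ω x₀ a b ε)
    (hγC : ClosedHomotopicIn (Ω \ singularSet e x₀) γ (circle x₀ a b ε)) :
    ∃ lam : A,
      HasCurveIntegral e (circle 0 a b ε) (fun x => Ring.inverse (point e x)) lam ∧
      HasCurveIntegral e γ
        (fun x => Φ x * Ring.inverse (point e x - point e x₀)) (lam * Φ x₀) := by
  obtain ⟨lam, hlam⟩ := hC.exists_integral_inverse
  obtain ⟨d, hd⟩ := hΦ.exists_hasDirectionalDerivOn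
  have hU := isOpen_regularSet e hΩ x₀
  have hc := continuousOn_mul_inverse (e := e) hΦ.1 x₀
  have hder := hasDirectionalDerivOn_mul_inverse hd x₀
  have hγC' : ClosedHomotopicIn (regularSet e Ω x₀) γ (circle x₀ a b ε) := by
    obtain ⟨H, h1, h2, h3⟩ := hγC
    exact ⟨H, h1, h2.mono_right (sdiff_singularSet_subset e Ω x₀), h3⟩
  obtain ⟨I, hIγ, hIε⟩ := exists_hasStieltjesIntegral_of_homotopic hU hc hder hγ
    (boundedVariationOn_circle x₀ a b ε) hγC'
  have hI : ∀ r, 0 < r → r ≤ ε → HasStieltjesIntegral (pointL e) (circle x₀ a b r)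
      (fun x => Φ x * Ring.inverse (point e x - point e x₀)) I := by
    intro r hr hrε
    obtain ⟨J, hJε, hJr⟩ := exists_hasStieltjesIntegral_of_homotopic hU hc hder
      (boundedVariationOn_circle x₀ a b ε) (boundedVariationOn_circle x₀ a b r)
      (closedHomotopicIn_circle fun s hs θ => hC.mem_regularSet
        (by nlinarith [hs.1, hs.2, hC.radius_pos]) (by nlinarith [hs.1, hs.2]) θ)
    rwa [hIε.unique hJε]
  rw [hC.integral_eq (hΦ.1.continuousAt (hΩ.mem_nhds hx₀)) hlam hI] at hIγ
  exact ⟨lam, hlam.hasCurveIntegral, hIγ.hasCurveIntegral⟩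

end

/-! ### From a normed algebra to the given topology -/

/-- A Hausdorff vector space topology on a finite-dimensional space is the module topology. -/
theorem topology_eq_moduleTopology (V : Type*) [AddCommGroup V] [Module ℂ V]
    [FiniteDimensional ℂ V] [τ : TopologicalSpace V] [IsTopologicalAddGroup V]
    [ContinuousSMul ℂ V] [T2Space V] : τ = moduleTopology ℂ V :=
  isModuleTopologyOfFiniteDimensional.eq_moduleTopology'

theorem norm_topology_eq_moduleTopology (A : Type*) [NormedCommRing A] [NormedAlgebra ℂ A]
    [FiniteDimensional ℂ A] :
    (PseudoMetricSpace.toUniformSpace.toTopologicalSpace : TopologicalSpace A) =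
      moduleTopology ℂ A :=
  topology_eq_moduleTopology A

end CauchyFormula

open CauchyFormula in
theorem theorem4 {A : Type*} [CommRing A] [Algebra ℂ A] [Module.Finite ℂ A]
    [TopologicalSpace A] [IsTopologicalAddGroup A] [ContinuousSMul ℂ A] [T2Space A]
    {k : ℕ} (hk : 2 ≤ k) (e : Fin k → A) (he : LinearIndependent ℝ e)
    (he₁ : e ⟨0, by omega⟩ = 1)
    (hsurj : ∀ f : A →ₐ[ℂ] ℂ, Function.Surjective fun x : Coord k => f (point e x))
    (Ω : Set (Coord k)) (hΩ_open : IsOpen Ω) (hΩ_conn : IsConnected Ω)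
    (hΩ_convex : ConvexAlongDirections e Ω)
    (Φ : Coord k → A) (hΦ : Monogenic e Ω Φ)
    (x₀ : Coord k) (hx₀ : x₀ ∈ Ω)
    (γ : ℝ → Coord k) (hγ : IsClosedRectifiableJordan γ)
    (a b : Coord k) (ε : ℝ) (hC : IsEmbracingCircle e Ω x₀ a b ε)
    (hγC : ClosedHomotopicIn (Ω \ singularSet e x₀) γ (circle x₀ a b ε)) :
    ∃ lam : A,
      HasCurveIntegral e (circle 0 a b ε) (fun x => Ring.inverse (point e x)) lam ∧
      HasCurveIntegral e γ
        (fun x => Φ x * Ring.inverse (point e x - point e x₀)) (lam * Φ x₀) := by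
  rename_i instRing instAlg instFin instTop instGroup instSMul instT2
  let basis := Module.finBasis ℂ A
  let _ : NormedRing (Matrix (Fin (Module.finrank ℂ A)) (Fin (Module.finrank ℂ A)) ℂ) :=
    Matrix.linftyOpNormedRing
  let _ : NormedAlgebra ℂ (Matrix (Fin (Module.finrank ℂ A)) (Fin (Module.finrank ℂ A)) ℂ) :=
    Matrix.linftyOpNormedAlgebra
  -- The regular representation embeds `A` in a matrix algebra, whose operator norm restricts to a
  -- submultiplicative norm. Both this norm topology and the given one are the module topology, so
  -- they coincide.
  let nr : NormedCommRing A := NormedCommRing.induced A _ (Algebra.leftMulMatrix basis)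
    (Algebra.leftMulMatrix_injective basis)
  let na : NormedAlgebra ℂ A := NormedAlgebra.induced ℂ A _ (Algebra.leftMulMatrix basis)
  have htop : instTop = nr.toPseudoMetricSpace.toUniformSpace.toTopologicalSpace :=
    (topology_eq_moduleTopology A).trans (@norm_topology_eq_moduleTopology A nr na instFin).symm
  subst htop
  have : CompleteSpace A := FiniteDimensional.complete ℂ A
  exact exists_hasCurveIntegral (e := e) hΩ_open hΦ hx₀ hγ.rectifiable hC hγC
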